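/- A \emph{half-square} is a right isosceles triangle (as a closed region). Fix a leg length $\ell>0$. An \emph{$n$-abolo} is a collection of $n\ge 1$ congruent copies of the half-square with legs $\ell$ in the plane such that any two copies meet in the empty set, in a single common vertex, or in a common edge, and such that the interior of their union is connected. Let $H(n)$ be the following cyclic chain of $4n$ half-squares $T_0,\dots,T_{4n-1}$ with legs $\ell/2$. In each $T_i$ one short edge $a_ib_i$ is chosen so that, walking from $a_i$ to $b_i$, the triangle lies to the right; the right angle of $T_i$ is at $a_i$ for even $i$ and at $b_i$ for odd $i$. The vertex $b_i$ is hinged to $a_{i+1}$ (indices modulo $4n$). A \emph{configuration} of $H(n)$ is a placement of the pieces by orientation-preserving rigid motions in which hinged vertices coincide; pieces may overlap. The \emph{initial configuration} is the one in which the hinged edges $a_ib_i$ are, in counterclockwise order, the sides of a regular $4n$-gon centred at the origin, with $a_0b_0$ pointing in the direction of the positive $x$-axis, so that all triangles point outward. \textbf{Theorem.} For every $n\ge 1$ and $\ell>0$, the hinged chain $H(n)$ can be rotated into every $n$-abolo: for every $n$-abolo made of half-squares with legs $\ell$, with union $X$, there is a continuous motion of $H(n)$ through configurations, from the initial configuration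 to a configuration in which the pieces have pairwise disjoint interiors, their union is exactly $X$, and no two hinges located at a common point cross. (Two hinges at a common point $p$ cross if, in the cyclic order of directions around $p$, the two piece corners joined by one hinge alternate with the two piece corners joined by the other.) -/

import Mathlib

open Complex

/-! The Euclidean plane is `ℂ`. -/

/-- The closed triangular region with vertices `v 0`, `v 1`, `v 2`. -/
def triRegion (v : Fin 3 → ℂ) : Set ℂ := convexHull ℝ (Set.range v)

/-- `e` is one of the three edges (closed segments) of the triangle `v`. -/
def IsTriEdge (e : Set ℂ) (v : Fin 3 → ℂ) : Prop :=
  ∃ i j : Fin 3, i ≠ j ∧ e = segment ℝ (v i) (v j)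

/-- The model half-square (right isosceles triangle) with legs of length `ℓ`;
the right angle is at the vertex `0`. -/
def halfSquare (ℓ : ℝ) : Fin 3 → ℂ := ![0, (ℓ : ℂ), (ℓ : ℂ) * I]

/-- `F` is a polyabolo made of `n` half-squares with legs of length `ℓ`: a collection of `n`
congruent copies of the half-square such that any two of them meet in nothing, in a common vertex,
or in a common edge, and such that the interior of their union is connected. -/
structure IsPolyabolo (ℓ : ℝ) (n : ℕ) (F : Fin n → Fin 3 → ℂ) : Prop where
  copy : ∀ k, ∃ φ : ℂ ≃ᵢ ℂ, ∀ m, F k m = φ (halfSquare ℓ m)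
  meet : ∀ j k, j ≠ k →
    triRegion (F j) ∩ triRegion (F k) = ∅ ∨
    (∃ p, p ∈ Set.range (F j) ∧ p ∈ Set.range (F k) ∧ triRegion (F j) ∩ triRegion (F k) = {p}) ∨
    (∃ e, IsTriEdge e (F j) ∧ IsTriEdge e (F k) ∧ triRegion (F j) ∩ triRegion (F k) = e)
  connected : IsConnected (interior (⋃ k, triRegion (F k)))

/-- Triangular pieces indexed by `ι`, hinged together at vertices by hinges indexed by `κ`.
The hinge `k` joins the vertex number `(endA k).2` of the piece `(endA k).1` to the vertex number
`(endB k).2` of the piece `(endB k).1`. -/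
structure HingedTriangles (ι κ : Type) where
  piece : ι → Fin 3 → ℂ
  endA : κ → ι × Fin 3
  endB : κ → ι × Fin 3

namespace HingedTriangles

variable {ι κ : Type}

/-- The vertices of the piece `i` after each piece has been moved by an orientation-preserving rigid
motion: `g i = (u, b)` moves the piece `i` by `z ↦ u * z + b`, where `u` is a unit complex number.
(Pieces are never flipped over.) -/
def placed (H : HingedTriangles ι κ) (g : ι → Circle × ℂ) (i : ι) (m : Fin 3) : ℂ :=
  ((g i).1 : ℂ) * H.piece i m + (g i).2

/-- The configurations of `H`: the placements of the pieces in which the two vertices joined by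
each hinge coincide. Overlap of pieces is allowed. -/
def configurations (H : HingedTriangles ι κ) : Set (ι → Circle × ℂ) :=
  {g | ∀ k, H.placed g (H.endA k).1 (H.endA k).2 = H.placed g (H.endB k).1 (H.endB k).2}

/-- The unit vector from the vertex `c.2` of the placed piece `c.1` towards the centroid of that
piece: it points into the corner of the piece at this vertex. -/
noncomputable def cornerDir (H : HingedTriangles ι κ) (g : ι → Circle × ℂ) (c : ι × Fin 3) : ℂ :=
  let w := (∑ m, H.placed g c.1 m) / 3 - H.placed g c.1 c.2
  w / (‖w‖ : ℂ)

/-- Two hinges at a common point `p` cross: on a circle around `p`, the two corners joined by the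
first hinge alternate with the two corners joined by the second hinge, that is, the two chords
representing the hinges intersect. -/
def HingesCross (H : HingedTriangles ι κ) (g : ι → Circle × ℂ) (k l : κ) : Prop :=
  H.placed g (H.endA k).1 (H.endA k).2 = H.placed g (H.endA l).1 (H.endA l).2 ∧
  (segment ℝ (H.cornerDir g (H.endA k)) (H.cornerDir g (H.endB k)) ∩
    segment ℝ (H.cornerDir g (H.endA l)) (H.cornerDir g (H.endB l))).Nonempty

/-- `g` is a configuration in which the pieces do not overlap, no two hinges cross,
and the pieces fill exactly the region `X`. -/
structure Forms (H : HingedTriangles ι κ) (g : ι → Circle × ℂ) (X : Set ℂ) : Prop where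
  config : g ∈ H.configurations
  nonoverlap : ∀ i j, i ≠ j →
    Disjoint (interior (triRegion (H.placed g i))) (interior (triRegion (H.placed g j)))
  noncrossing : ∀ k l, k ≠ l → ¬ H.HingesCross g k l
  union : ⋃ i, triRegion (H.placed g i) = X

/-- Starting from the configuration `g₀`, the hinged pieces can be rotated into the region `X`:
a continuous motion through configurations (the pieces stay attached at the hinges, but may overlap
on the way) leads from `g₀` to a configuration that forms `X`. -/
def RotatesInto (H : HingedTriangles ι κ) (g₀ : ι → Circle × ℂ) (X : Set ℂ) : Prop :=
  ∃ g, JoinedIn H.configurations g₀ g ∧ H.Forms g X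

end HingedTriangles

/-- The cycle of `N` right isosceles triangles with legs of length `s`, hinged at the two endpoints
of a short edge. Vertex `1` of each piece is hinged to vertex `0` of the next piece in the cyclic
order. Every piece lies to the right of its hinged edge, directed from vertex `0` to vertex `1`;
the right angle is at vertex `0` for the pieces of even index and at vertex `1` for those of odd
index, so that the orientations alternate. -/
noncomputable def triangleCycle (s : ℝ) (N : ℕ) : HingedTriangles (Fin N) (Fin N) where
  piece i := if Even i.val then ![0, (s : ℂ), -(s : ℂ) * I] else ![0, (s : ℂ), (s : ℂ) - (s : ℂ) * I]
  endA k := (k, 1)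
  endB k := (finRotate N k, 0)

/-- The position of `triangleCycle s N` in which the hinges are, in counterclockwise order, the
vertices of a regular `N`-gon with side `s` centred at the origin; all triangles point outward. -/
noncomputable def regularPosition (s : ℝ) (N : ℕ) : Fin N → Circle × ℂ := fun i =>
  (Circle.exp (2 * Real.pi * i / N),
    s * exp (2 * Real.pi * I * i / N) / (exp (2 * Real.pi * I / N) - 1))

/-! Cut each half-square with legs `2 * s` into four with legs `s`, as in `subTri`. These form a
closed hinged chain whose four hinges lie at the midpoints of the edges: one on each leg, two on the
hypotenuse. Hinged edges have length `s`, and the right angles alternate between their starts and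
ends.

When two members of the polyabolo share an edge, each has a hinge at its midpoint. Exchanging the
successors of these two hinges multiplies the successor permutation by a transposition and merges
two cycles into one. Since the interior of the union is connected and a countable set cannot
separate a connected open set of the plane, every proper part of the collection shares an edge with
the rest. The merging can thus be done along a spanning tree (`exists_common_edge`,
`exists_matching`), leaving one cycle of `4 * n` pieces. Only equally long edges are matched, so
orientations still alternate and the cycle is `triangleCycle`. Hinges at a common midpoint are
separated by explicit lines, hence do not cross (`not_hinges_cross`).

For the motion, a configuration amounts to a base point and a closed sequence of unit vectors. If a
permutation of the indices negates two such sequences, turning each vector steadily from one to the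
other keeps the sum zero (`exists_path_of_antiinvariant`). The regular polygon pairs opposite edges,
the target pairs pieces `j` and `3 - j` of each half-square; both are connected to the flat zigzag
with alternating signs. -/

/-! ### Triangles, segments and similarities in the plane. -/

theorem mem_triRegion {v : Fin 3 → ℂ} {z : ℂ} :
    z ∈ triRegion v ↔ ∃ a b c : ℝ, 0 ≤ a ∧ 0 ≤ b ∧ 0 ≤ c ∧ a + b + c = 1 ∧
      z = a * v 0 + b * v 1 + c * v 2 := by
  have hr : Set.range v = {v 0, v 1, v 2} := by
    ext z
    simp only [Set.mem_range, Fin.exists_fin_succ, Set.mem_insert_iff, Set.mem_singleton_iff]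
    simp [eq_comm]
  rw [triRegion, hr, convexHull_insert (by simp), convexHull_pair]
  simp only [convexJoin_singleton_left, Set.mem_iUnion, exists_prop]
  constructor
  · rintro ⟨y, ⟨b, c, hb, hc, hbc, rfl⟩, a, d, ha, hd, had, rfl⟩
    refine ⟨a, d * b, d * c, ha, by positivity, by positivity, by linear_combination had + d * hbc, ?_⟩
    simp only [real_smul]; push_cast; ring
  · rintro ⟨a, b, c, ha, hb, hc, h, rfl⟩
    rcases eq_or_lt_of_le (add_nonneg hb hc) with h0 | h0
    · have : b = 0 := by linarith
      have : c = 0 := by linarith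
      have : a = 1 := by linarith
      subst_vars
      exact ⟨v 1, left_mem_segment _ _ _, by simpa using left_mem_segment ℝ (v 0) (v 1)⟩
    · refine ⟨(b / (b + c) : ℝ) • v 1 + (c / (b + c) : ℝ) • v 2,
        ⟨_, _, by positivity, by positivity, by field_simp, rfl⟩,
        a, b + c, ha, h0.le, by linarith, ?_⟩
      have : (b : ℂ) + c ≠ 0 := by exact_mod_cast h0.ne'
      simp only [real_smul]; push_cast; field_simp; ring

/-- The similarity `z ↦ R + s u z`. -/
noncomputable def frame (s : ℝ) (R : ℂ) (u : Circle) (z : ℂ) : ℂ := R + s * u * z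

theorem frame_injective {s : ℝ} (hs : 0 < s) (R : ℂ) (u : Circle) :
    Function.Injective (frame s R u) := by
  intro z w h
  simpa [frame, hs.ne'] using h

theorem triRegion_frame (s : ℝ) (R : ℂ) (u : Circle) (v : Fin 3 → ℂ) :
    triRegion (fun m => frame s R u (v m)) = frame s R u '' triRegion v := by
  ext z
  simp only [Set.mem_image, mem_triRegion]
  constructor
  · rintro ⟨a, b, c, ha, hb, hc, h, rfl⟩
    refine ⟨_, ⟨a, b, c, ha, hb, hc, h, rfl⟩, ?_⟩
    have h' : (a : ℂ) + b + c = 1 := by exact_mod_cast h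
    simp only [frame]
    linear_combination - R * h'
  · rintro ⟨_, ⟨a, b, c, ha, hb, hc, h, rfl⟩, rfl⟩
    refine ⟨a, b, c, ha, hb, hc, h, ?_⟩
    have h' : (a : ℂ) + b + c = 1 := by exact_mod_cast h
    simp only [frame]
    linear_combination - R * h'

theorem frame_segment (s : ℝ) (R : ℂ) (u : Circle) (x y : ℂ) :
    segment ℝ (frame s R u x) (frame s R u y) = frame s R u '' segment ℝ x y := by
  ext z
  simp only [segment, Set.mem_ofPred, Set.mem_image, real_smul]
  constructor
  · rintro ⟨a, b, ha, hb, h, rfl⟩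
    refine ⟨_, ⟨a, b, ha, hb, h, rfl⟩, ?_⟩
    have h' : (a : ℂ) + b = 1 := by exact_mod_cast h
    simp only [frame]
    linear_combination - R * h'
  · rintro ⟨_, ⟨a, b, ha, hb, h, rfl⟩, rfl⟩
    refine ⟨a, b, ha, hb, h, ?_⟩
    have h' : (a : ℂ) + b = 1 := by exact_mod_cast h
    simp only [frame]
    linear_combination R * h'

theorem isOpen_frame_image {s : ℝ} (hs : 0 < s) (R : ℂ) (u : Circle) {O : Set ℂ} (hO : IsOpen O) :
    IsOpen (frame s R u '' O) := by
  have hne : (s : ℂ) * u ≠ 0 := by simp [hs.ne']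
  have : frame s R u '' O = (fun z => (z - R) / (s * u)) ⁻¹' O := by
    ext z
    constructor
    · rintro ⟨w, hw, rfl⟩
      simpa [frame, hne, hs.ne'] using hw
    · intro h
      exact ⟨_, h, by simp only [frame]; rw [mul_div_cancel₀ _ hne]; ring⟩
  rw [this]
  exact hO.preimage (by fun_prop)

/-- A small step in the direction of the conjugate of `d` strictly increases the real part of `d *
z`, so no ball fits into the line. -/
theorem interior_eq_empty_of_subset_line {S : Set ℂ} {d : ℂ} {c : ℝ} (hd : d ≠ 0)
    (h : ∀ z ∈ S, (d * z).re = c) : interior S = ∅ := by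
  rw [Set.eq_empty_iff_forall_notMem]
  intro z hz
  obtain ⟨ε, hε, hb⟩ := Metric.isOpen_iff.mp isOpen_interior z hz
  have hdn : 0 < ‖d‖ := norm_pos_iff.mpr hd
  set t : ℝ := ε / 2 / ‖d‖
  have ht : 0 < t := by positivity
  have hmem : z + t * (starRingEnd ℂ) d ∈ Metric.ball z ε := by
    rw [mem_ball_iff_norm]
    simp only [add_sub_cancel_left, norm_mul, norm_real, RCLike.norm_conj, Real.norm_eq_abs,
      abs_of_pos ht]
    simp only [t]; field_simp; linarith
  have h1 := h _ (interior_subset hz)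
  have h2 := h _ (interior_subset (hb hmem))
  have h3 : (d * (z + t * (starRingEnd ℂ) d)).re = (d * z).re + t * normSq d := by
    rw [show d * (z + t * (starRingEnd ℂ) d) = d * z + t * (d * (starRingEnd ℂ) d) by ring,
      mul_conj, add_re, ← ofReal_mul, ofReal_re]
  have : 0 < t * normSq d := mul_pos ht (normSq_pos.mpr hd)
  linarith

theorem interior_segment_eq_empty {x y : ℂ} : interior (segment ℝ x y) = ∅ := by
  rcases eq_or_ne x y with rfl | hxy
  · rw [segment_same]; exact interior_singleton x
  refine interior_eq_empty_of_subset_line (d := I * (starRingEnd ℂ) (y - x))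
    (c := (I * (starRingEnd ℂ) (y - x) * x).re) 
    (mul_ne_zero I_ne_zero ((map_ne_zero _).mpr (sub_ne_zero.mpr hxy.symm))) ?_
  rintro _ ⟨a, b, -, -, h, rfl⟩
  obtain rfl : a = 1 - b := by linarith
  simp
  ring

/-- Segments on different sides of a line do not meet. -/
theorem not_segment_inter_nonempty {a b a' b' d : ℂ} {c : ℝ} (ha : (d * a).re < c)
    (hb : (d * b).re < c) (ha' : c < (d * a').re) (hb' : c < (d * b').re) :
    ¬ (segment ℝ a b ∩ segment ℝ a' b').Nonempty := by
  rintro ⟨_, ⟨x, y, hx, hy, hxy, rfl⟩, ⟨x', y', hx', hy', hxy', h⟩⟩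
  have h2 := congrArg (fun z => (d * z).re) h
  have e : ∀ (x y : ℝ) (a b : ℂ), (d * (x • a + y • b)).re = x * (d * a).re + y * (d * b).re := by
    intros; simp; ring
  simp only [e] at h2
  have h3 : x * (d * a).re + y * (d * b).re < c := by
    rcases eq_or_lt_of_le hx with rfl | hx
    · have : y = 1 := by linarith
      subst this; linarith
    · obtain rfl : y = 1 - x := by linarith
      nlinarith
  have h4 : c < x' * (d * a').re + y' * (d * b').re := by
    rcases eq_or_lt_of_le hx' with rfl | hx'
    · have : y' = 1 := by linarith
      subst this; linarith
    · obtain rfl : y' = 1 - x' := by linarith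
      nlinarith
  linarith

/-- A segment determines its midpoint and, up to sign, its half-edge vector. -/
theorem segment_midpoint_unique {p q h k : ℂ}
    (e : segment ℝ (p - h) (p + h) = segment ℝ (q - k) (q + k)) :
    p = q ∧ (h = k ∨ h = -k) := by
  have key : ∀ {p q h k : ℂ}, segment ℝ (q - k) (q + k) ⊆ segment ℝ (p - h) (p + h) →
      ∃ t t' : ℝ, |t| ≤ 1 ∧ |t'| ≤ 1 ∧ q + k = p + t * h ∧ q - k = p + t' * h := by
    intro p q h k e
    obtain ⟨a, b, ha, hb, hab, h1⟩ := e (right_mem_segment ℝ (q - k) (q + k))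
    obtain ⟨a', b', ha', hb', hab', h2⟩ := e (left_mem_segment ℝ (q - k) (q + k))
    refine ⟨b - a, b' - a', by rw [abs_le]; constructor <;> linarith,
      by rw [abs_le]; constructor <;> linarith, ?_, ?_⟩
    · have : (a : ℂ) + b = 1 := by exact_mod_cast hab
      rw [← h1]; simp only [real_smul]; push_cast; linear_combination p * this
    · have : (a' : ℂ) + b' = 1 := by exact_mod_cast hab'
      rw [← h2]; simp only [real_smul]; push_cast; linear_combination p * this
  obtain ⟨t, t', ht, ht', h1, h2⟩ := key e.ge
  obtain ⟨r, r', hr, hr', h3, h4⟩ := key e.le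
  rw [abs_le] at ht ht' hr hr'
  have hk : k = ((t - t') / 2 : ℝ) * h := by push_cast; linear_combination (h1 - h2) / 2
  have hh : h = ((r - r') / 2 : ℝ) * k := by push_cast; linear_combination (h3 - h4) / 2
  rcases eq_or_ne h 0 with rfl | h0
  · simp only [mul_zero] at hk
    subst hk
    simp at h1
    simp [h1]
  have hprod : (r - r') / 2 * ((t - t') / 2) = 1 := by
    have : (((r - r') / 2 * ((t - t') / 2) : ℝ) : ℂ) * h = 1 * h := by
      conv_rhs => rw [hh, hk]
      push_cast; ring
    exact_mod_cast mul_right_cancel₀ h0 this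
  -- The two scaling factors have absolute value at most one and product one, so both are `±1`; a
  -- difference `t - t'` of size two forces `t` and `t'` to the ends of their range.
  have hcases : (t = 1 ∧ t' = -1) ∨ (t = -1 ∧ t' = 1) := by
    set x := (r - r') / 2
    set y := (t - t') / 2 with hy
    have hx1 : |x| ≤ 1 := by rw [abs_le]; constructor <;> simp only [x] <;> linarith
    have hy1 : |y| ≤ 1 := by rw [abs_le]; constructor <;> simp only [y] <;> linarith
    have : |x| * |y| = 1 := by rw [← abs_mul, hprod, abs_one]
    have : |y| = 1 := by nlinarith [abs_nonneg x, abs_nonneg y]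
    rcases (abs_eq zero_le_one).mp this with h | h
    · left; constructor <;> linarith
    · right; constructor <;> linarith
  rcases hcases with ⟨rfl, rfl⟩ | ⟨rfl, rfl⟩
  · push_cast at h1 h2
    exact ⟨by linear_combination -(h1 + h2) / 2, .inl (by linear_combination (h2 - h1) / 2)⟩
  · push_cast at h1 h2
    exact ⟨by linear_combination -(h1 + h2) / 2, .inr (by linear_combination (h1 - h2) / 2)⟩

/-! ### The model half-square and its dissection into four pieces. -/

/-- The model half-square with legs of length `2`. -/
noncomputable def modelTri : Fin 3 → ℂ := ![0, 2, 2 * I]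

/-- The four half-squares with legs of length `1` that fill `modelTri`. The vertices `0` and `1` of
each of them are the ends of its hinged edge. -/
noncomputable def subTri : Fin 4 → Fin 3 → ℂ :=
  ![![1, 1 + I, 2], ![1 + I, I, 2 * I], ![I, 1 + I, 0], ![1 + I, 1, 0]]

/-- The vertex number `1` of each piece is the midpoint of an edge of `modelTri`; this is half of
that edge, as a vector with `modelTri` on its left. -/
noncomputable def halfEdge : Fin 4 → ℂ := ![I - 1, -I, I - 1, 1]

theorem subTri_one_values : subTri 0 1 = 1 + I ∧ subTri 1 1 = I ∧ subTri 2 1 = 1 + I ∧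
    subTri 3 1 = 1 := ⟨rfl, rfl, rfl, rfl⟩

theorem halfEdge_values : halfEdge 0 = I - 1 ∧ halfEdge 1 = -I ∧ halfEdge 2 = I - 1 ∧
    halfEdge 3 = 1 := ⟨rfl, rfl, rfl, rfl⟩

theorem mem_triRegion_modelTri {z : ℂ} :
    z ∈ triRegion modelTri ↔ 0 ≤ z.re ∧ 0 ≤ z.im ∧ z.re + z.im ≤ 2 := by
  rw [mem_triRegion]
  constructor
  · rintro ⟨a, b, c, ha, hb, hc, h, rfl⟩
    simp [modelTri]
    refine ⟨?_, ?_, ?_⟩ <;> linarith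
  · rintro ⟨h1, h2, h3⟩
    refine ⟨1 - (z.re + z.im) / 2, z.re / 2, z.im / 2, by linarith, by linarith, by linarith,
      by ring, ?_⟩
    apply Complex.ext <;> simp [modelTri]

theorem mem_triRegion_subTri_zero {z : ℂ} :
    z ∈ triRegion (subTri 0) ↔ 1 ≤ z.re ∧ 0 ≤ z.im ∧ z.re + z.im ≤ 2 := by
  rw [mem_triRegion]
  constructor
  · rintro ⟨a, b, c, ha, hb, hc, h, rfl⟩
    simp [subTri]
    refine ⟨?_, ?_, ?_⟩ <;> linarith
  · rintro ⟨h1, h2, h3⟩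
    refine ⟨2 - (z.re + z.im), z.im, z.re - 1, by linarith, by linarith, by linarith,
      by ring, ?_⟩
    apply Complex.ext <;> simp [subTri] <;> ring

theorem mem_triRegion_subTri_one {z : ℂ} :
    z ∈ triRegion (subTri 1) ↔ 0 ≤ z.re ∧ 1 ≤ z.im ∧ z.re + z.im ≤ 2 := by
  rw [mem_triRegion]
  constructor
  · rintro ⟨a, b, c, ha, hb, hc, h, rfl⟩
    simp [subTri]
    refine ⟨?_, ?_, ?_⟩ <;> linarith
  · rintro ⟨h1, h2, h3⟩
    refine ⟨z.re, 2 - (z.re + z.im), z.im - 1, by linarith, by linarith, by linarith,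
      by ring, ?_⟩
    apply Complex.ext <;> simp [subTri] <;> ring

theorem mem_triRegion_subTri_two {z : ℂ} :
    z ∈ triRegion (subTri 2) ↔ 0 ≤ z.re ∧ z.re ≤ z.im ∧ z.im ≤ 1 := by
  rw [mem_triRegion]
  constructor
  · rintro ⟨a, b, c, ha, hb, hc, h, rfl⟩
    simp [subTri]
    refine ⟨?_, ?_, ?_⟩ <;> linarith
  · rintro ⟨h1, h2, h3⟩
    refine ⟨z.im - z.re, z.re, 1 - z.im, by linarith, by linarith, by linarith,
      by ring, ?_⟩
    apply Complex.ext <;> simp [subTri]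

theorem mem_triRegion_subTri_three {z : ℂ} :
    z ∈ triRegion (subTri 3) ↔ 0 ≤ z.im ∧ z.im ≤ z.re ∧ z.re ≤ 1 := by
  rw [mem_triRegion]
  constructor
  · rintro ⟨a, b, c, ha, hb, hc, h, rfl⟩
    simp [subTri]
    refine ⟨?_, ?_, ?_⟩ <;> linarith
  · rintro ⟨h1, h2, h3⟩
    refine ⟨z.im, z.re - z.im, 1 - z.re, by linarith, by linarith, by linarith,
      by ring, ?_⟩
    apply Complex.ext <;> simp [subTri]

theorem iUnion_triRegion_subTri : ⋃ j, triRegion (subTri j) = triRegion modelTri := by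
  ext z
  rw [Set.mem_iUnion]
  rw [Fin.exists_fin_succ, Fin.exists_fin_succ, Fin.exists_fin_two]
  change z ∈ triRegion (subTri 0) ∨ z ∈ triRegion (subTri 1) ∨ z ∈ triRegion (subTri 2) ∨
    z ∈ triRegion (subTri 3) ↔ _
  simp only [mem_triRegion_subTri_zero, mem_triRegion_subTri_one,
    mem_triRegion_subTri_two, mem_triRegion_subTri_three, mem_triRegion_modelTri]
  constructor
  · rintro (h | h | h | h)
    · exact ⟨by linarith, by linarith, by linarith⟩
    · exact ⟨by linarith, by linarith, by linarith⟩
    · exact ⟨by linarith, by linarith, by linarith⟩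
    · exact ⟨by linarith, by linarith, by linarith⟩
  · rintro ⟨h1, h2, h3⟩
    rcases le_total 1 z.re with h | h
    · exact .inl ⟨h, h2, h3⟩
    rcases le_total 1 z.im with h' | h'
    · exact .inr (.inl ⟨h1, h', h3⟩)
    rcases le_total z.re z.im with h'' | h''
    · exact .inr (.inr (.inl ⟨h1, h'', h'⟩))
    · exact .inr (.inr (.inr ⟨h2, h'', h⟩))

/-- The lines `x = 1`, `y = 1` and `x = y` separate the four pieces: the first cuts off piece 0, the
second piece 1, and the third divides the remaining square. -/
theorem subTri_inter_subset_line {i j : Fin 4} (hij : i ≠ j) :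
    ∃ (d : ℂ) (c : ℝ), d ≠ 0 ∧ ∀ z ∈ triRegion (subTri i) ∩ triRegion (subTri j), (d * z).re = c := by
  wlog h : i < j generalizing i j
  · simpa only [Set.inter_comm] using this hij.symm (lt_of_le_of_ne (not_lt.mp h) hij.symm)
  have h1 : ∀ z : ℂ, (-I * z).re = z.im := by simp
  have h2 : ∀ z : ℂ, ((1 + I) * z).re = z.re - z.im := by simp [add_mul]; intros; ring
  fin_cases i <;> fin_cases j <;> first | exact absurd h (by decide) | skip
  · refine ⟨1, 1, by simp, fun z ⟨ha, hb⟩ => ?_⟩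
    have h3 := mem_triRegion_subTri_zero.mp ha; have h4 := mem_triRegion_subTri_one.mp hb
    rw [one_mul]; linarith
  · refine ⟨1, 1, by simp, fun z ⟨ha, hb⟩ => ?_⟩
    have h3 := mem_triRegion_subTri_zero.mp ha; have h4 := mem_triRegion_subTri_two.mp hb
    rw [one_mul]; linarith
  · refine ⟨1, 1, by simp, fun z ⟨ha, hb⟩ => ?_⟩
    have h3 := mem_triRegion_subTri_zero.mp ha; have h4 := mem_triRegion_subTri_three.mp hb
    rw [one_mul]; linarith
  · refine ⟨-I, 1, by simp, fun z ⟨ha, hb⟩ => ?_⟩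
    have h3 := mem_triRegion_subTri_one.mp ha; have h4 := mem_triRegion_subTri_two.mp hb
    rw [h1]; linarith
  · refine ⟨-I, 1, by simp, fun z ⟨ha, hb⟩ => ?_⟩
    have h3 := mem_triRegion_subTri_one.mp ha; have h4 := mem_triRegion_subTri_three.mp hb
    rw [h1]; linarith
  · refine ⟨1 + I, 0, fun h => by simpa using congrArg re h, fun z ⟨ha, hb⟩ => ?_⟩
    have h3 := mem_triRegion_subTri_two.mp ha; have h4 := mem_triRegion_subTri_three.mp hb
    rw [h2]; linarith

theorem disjoint_interior_frame_subTri {s : ℝ} (hs : 0 < s) (R : ℂ) (u : Circle) {i j : Fin 4}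
    (hij : i ≠ j) : Disjoint (interior (triRegion fun m => frame s R u (subTri i m)))
      (interior (triRegion fun m => frame s R u (subTri j m))) := by
  obtain ⟨d, c, hd, hl⟩ := subTri_inter_subset_line hij
  rw [Set.disjoint_iff_inter_eq_empty, ← interior_inter, triRegion_frame, triRegion_frame,
    ← Set.image_inter (frame_injective hs R u)]
  refine interior_eq_empty_of_subset_line (d := d * (u : ℂ)⁻¹) (c := s * c + (d * (u : ℂ)⁻¹ * R).re)
    (by simp [hd]) ?_
  rintro _ ⟨z, hz, rfl⟩
  rw [← hl z hz, show d * (u : ℂ)⁻¹ * frame s R u z = s * (d * z) + d * (u : ℂ)⁻¹ * R by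
    simp only [frame]; field_simp; ring, add_re, re_ofReal_mul]

theorem triRegion_frame_subTri_subset (s : ℝ) (R : ℂ) (u : Circle) (j : Fin 4) :
    triRegion (fun m => frame s R u (subTri j m)) ⊆ triRegion fun m => frame s R u (modelTri m) := by
  rw [triRegion_frame, triRegion_frame, ← iUnion_triRegion_subTri]
  exact Set.image_mono (Set.subset_iUnion (fun j => triRegion (subTri j)) j)

theorem iUnion_triRegion_frame_subTri (s : ℝ) (R : ℂ) (u : Circle) :
    ⋃ j, triRegion (fun m => frame s R u (subTri j m)) =
      triRegion fun m => frame s R u (modelTri m) := by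
  simp only [triRegion_frame, ← iUnion_triRegion_subTri, Set.image_iUnion]

theorem nonempty_interior_triRegion_frame {s : ℝ} (hs : 0 < s) (R : ℂ) (u : Circle) :
    (interior (triRegion fun m => frame s R u (modelTri m))).Nonempty := by
  have ho : IsOpen {z : ℂ | 0 < z.re ∧ 0 < z.im ∧ z.re + z.im < 2} :=
    (isOpen_lt continuous_const continuous_re).inter
      ((isOpen_lt continuous_const continuous_im).inter
        (isOpen_lt (continuous_re.add continuous_im) continuous_const))
  refine ⟨frame s R u (1 / 2 + I / 2), mem_interior.mpr
    ⟨_, ?_, isOpen_frame_image hs R u ho, Set.mem_image_of_mem _ ?_⟩⟩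
  · rw [triRegion_frame]
    refine Set.image_mono fun z hz => ?_
    rw [mem_triRegion_modelTri]
    exact ⟨hz.1.le, hz.2.1.le, hz.2.2.le⟩
  · norm_num

theorem subTri_one_mem (j : Fin 4) : subTri j 1 ∈ triRegion modelTri := by
  rw [mem_triRegion_modelTri]
  fin_cases j <;> norm_num [subTri]

theorem subTri_one_add_mem (j : Fin 4) :
    subTri j 1 + (1 / 2 : ℝ) * (I * halfEdge j) ∈ triRegion modelTri := by
  rw [mem_triRegion_modelTri]
  fin_cases j <;> norm_num [subTri, halfEdge]

theorem subTri_one_ne_modelTri (j : Fin 4) (m : Fin 3) : subTri j 1 ≠ modelTri m := by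
  intro h
  have h1 := congrArg re h
  have h2 := congrArg im h
  fin_cases j <;> fin_cases m <;> simp [subTri, modelTri] at h1 h2

theorem halfEdge_ne_zero (j : Fin 4) : halfEdge j ≠ 0 := by
  intro h
  have h1 := congrArg re h
  have h2 := congrArg im h
  fin_cases j <;> simp [halfEdge] at h1 h2

/-- The indices 0, 1, 3 label the hypotenuse and the two legs once each. Index 2 is excluded because
its hinge is a second one at the midpoint of the hypotenuse. -/
theorem IsTriEdge.exists_eq_segment {e : Set ℂ} {s : ℝ} {R : ℂ} {u : Circle}
    (h : IsTriEdge e fun m => frame s R u (modelTri m)) :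
    ∃ j, j ≠ 2 ∧ e = frame s R u '' segment ℝ (subTri j 1 - halfEdge j) (subTri j 1 + halfEdge j) := by
  obtain ⟨a, b, hab, rfl⟩ := h
  simp only [frame_segment]
  have h0 : segment ℝ (2 : ℂ) (2 * I) =
      segment ℝ (subTri 0 1 - halfEdge 0) (subTri 0 1 + halfEdge 0) := by
    congr 1 <;> apply Complex.ext <;> norm_num [subTri_one_values, halfEdge_values]
  have h1 : segment ℝ (2 * I) 0 =
      segment ℝ (subTri 1 1 - halfEdge 1) (subTri 1 1 + halfEdge 1) := by
    congr 1 <;> apply Complex.ext <;> norm_num [subTri_one_values, halfEdge_values]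
  have h3 : segment ℝ 0 (2 : ℂ) =
      segment ℝ (subTri 3 1 - halfEdge 3) (subTri 3 1 + halfEdge 3) := by
    congr 1 <;> apply Complex.ext <;> norm_num [subTri_one_values, halfEdge_values]
  wlog h : a < b generalizing a b
  · simpa only [segment_symm] using this b a hab.symm (lt_of_le_of_ne (not_lt.mp h) hab.symm)
  fin_cases a <;> fin_cases b <;> first | exact absurd h (by decide) | skip
  · exact ⟨3, by decide, by rw [← h3]; rfl⟩
  · exact ⟨1, by decide, by rw [← h1, segment_symm]; rfl⟩
  · exact ⟨0, by decide, by rw [← h0]; rfl⟩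

theorem subTri_one_eq_of_mem_segment {i j : Fin 4}
    (h : subTri i 1 ∈ segment ℝ (subTri j 1 - halfEdge j) (subTri j 1 + halfEdge j)) :
    subTri i 1 = subTri j 1 ∧ halfEdge i = halfEdge j := by
  obtain ⟨a, b, ha, hb, hab, h⟩ := h
  have h1 := congrArg re h
  have h2 := congrArg im h
  fin_cases i <;> fin_cases j <;> first
    | exact ⟨rfl, rfl⟩
    | (exfalso; simp [subTri, halfEdge] at h1 h2 <;> linarith)

theorem subTri_one_injOn {i j : Fin 4} (hi : i ≠ 2) (hj : j ≠ 2) (h : subTri i 1 = subTri j 1) :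
    i = j := by
  have h1 := congrArg re h
  have h2 := congrArg im h
  fin_cases i <;> fin_cases j <;> first
    | rfl
    | exact absurd rfl hi
    | exact absurd rfl hj
    | (exfalso; simp [subTri] at h1 h2)

theorem eq_zero_of_subTri_one_eq {j : Fin 4} (hj : j ≠ 2) (h : subTri j 1 = subTri 2 1) : j = 0 :=
  subTri_one_injOn hj (by decide) (h.trans rfl)

/-! ### Closed chains and their motions. -/

/-- Two closed chains of unit vectors that are both reversed by the same permutation of the indices
are joined by a path of closed chains. -/
theorem exists_path_of_antiinvariant {N : ℕ} (π : Equiv.Perm (Fin N)) (u v : Fin N → Circle)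
    (hu : ∀ i, u (π i) = -u i) (hv : ∀ i, v (π i) = -v i) :
    ∃ γ : unitInterval → Fin N → Circle, Continuous γ ∧ γ 0 = u ∧ γ 1 = v ∧
      ∀ t, ∑ i, (γ t i : ℂ) = 0 := by
  refine ⟨fun t i => u i * Circle.exp (t * arg ((v i : ℂ) / u i)), ?_, ?_, ?_, ?_⟩
  · fun_prop
  · ext i; simp
  · funext i
    have h : Circle.exp (arg ((v i / u i : Circle) : ℂ)) = v i / u i := Circle.exp_arg _
    simp only [Set.Icc.coe_one, one_mul]
    rw [← Circle.coe_div, h, mul_div_cancel]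
  · intro t
    set f : Fin N → ℂ := fun i => ((u i * Circle.exp (t * arg ((v i : ℂ) / u i)) : Circle) : ℂ)
    have h1 : ∑ i, f (π i) = ∑ i, f i := Equiv.sum_comp π f
    -- The quotient `v i / u i` is the same at `i` and `π i`, so paired vectors turn through the
    -- same angle and remain opposite; the sum then equals its own negative.
    have h2 : ∀ i, f (π i) = - f i := by
      intro i
      simp only [f, hu, hv, Circle.coe_mul, Circle.coe_neg, neg_div_neg_eq, neg_mul]
    simp only [h2, Finset.sum_neg_distrib] at h1
    exact self_eq_neg.mp h1.symm

theorem triangleCycle_placed_zero (s : ℝ) (N : ℕ) (g : Fin N → Circle × ℂ) (i : Fin N) :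
    (triangleCycle s N).placed g i 0 = (g i).2 := by
  unfold HingedTriangles.placed triangleCycle
  dsimp only
  split_ifs <;> simp

theorem triangleCycle_placed_one (s : ℝ) (N : ℕ) (g : Fin N → Circle × ℂ) (i : Fin N) :
    (triangleCycle s N).placed g i 1 = ((g i).1 : ℂ) * s + (g i).2 := by
  unfold HingedTriangles.placed triangleCycle
  dsimp only
  split_ifs <;> simp

theorem mem_configurations_triangleCycle {s : ℝ} {N : ℕ} {g : Fin N → Circle × ℂ} :
    g ∈ (triangleCycle s N).configurations ↔
      ∀ i, ((g i).1 : ℂ) * s + (g i).2 = (g (finRotate N i)).2 := by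
  simp only [HingedTriangles.configurations, Set.mem_ofPred]
  refine forall_congr' fun i => ?_
  rw [← triangleCycle_placed_one s N g i, ← triangleCycle_placed_zero s N g (finRotate N i)]
  rfl

/-- The configuration with prescribed directions of the hinged edges and prescribed base point. -/
noncomputable def chainConfig (s : ℝ) {N : ℕ} (c : ℂ) (u : Fin N → Circle) : Fin N → Circle × ℂ :=
  fun i => (u i, c + s * ∑ j with j < i, (u j : ℂ))

/-- The partial sums satisfy every hinge condition but the last by construction; the hinge from the
last piece back to piece 0 is where the total must vanish. -/
theorem chainConfig_mem {s : ℝ} {N : ℕ} {c : ℂ} {u : Fin N → Circle} (hu : ∑ i, (u i : ℂ) = 0) :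
    chainConfig s c u ∈ (triangleCycle s N).configurations := by
  rw [mem_configurations_triangleCycle]
  rcases N with - | N
  · exact fun i => i.elim0
  intro i
  induction i using Fin.lastCases with
  | last =>
    have h : (Finset.univ.filter fun j : Fin (N + 1) => j < Fin.last N) =
        Finset.univ.erase (Fin.last N) := by
      ext j; simp [Fin.lt_last_iff_ne_last]
    have h2 := Finset.add_sum_erase Finset.univ (fun i => (u i : ℂ)) (Finset.mem_univ (Fin.last N))
    simp only [chainConfig, finRotate_last, h, Fin.not_lt_zero, Finset.filter_false,
      Finset.sum_empty]
    rw [hu] at h2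
    linear_combination (s : ℂ) * h2
  | cast i =>
    have h : (Finset.univ.filter fun j : Fin (N + 1) => j < i.succ) =
        insert i.castSucc (Finset.univ.filter fun j : Fin (N + 1) => j < i.castSucc) := by
      ext j; simp only [Finset.mem_filter_univ, Finset.mem_insert, Fin.lt_def, Fin.ext_iff,
        Fin.val_succ, Fin.val_castSucc]; omega
    simp only [chainConfig, finRotate_apply, Fin.coeSucc_eq_succ, h]
    rw [Finset.sum_insert (by simp)]
    ring

/-- The hinge conditions determine all positions recursively. This brings both the regular polygon
and the final placement within reach of `joinedIn_chainConfig`. -/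
theorem eq_chainConfig {s : ℝ} {N : ℕ} {g : Fin (N + 1) → Circle × ℂ}
    (hg : g ∈ (triangleCycle s (N + 1)).configurations) :
    g = chainConfig s (g 0).2 (fun i => (g i).1) := by
  rw [mem_configurations_triangleCycle] at hg
  funext i
  refine Prod.ext rfl ?_
  induction i using Fin.induction with
  | zero => simp [chainConfig]
  | succ i ih =>
    have h : (Finset.univ.filter fun j : Fin (N + 1) => j < i.succ) =
        insert i.castSucc (Finset.univ.filter fun j : Fin (N + 1) => j < i.castSucc) := by
      ext j; simp only [Finset.mem_filter_univ, Finset.mem_insert, Fin.lt_def, Fin.ext_iff,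
        Fin.val_succ, Fin.val_castSucc]; omega
    have h1 := hg i.castSucc
    rw [finRotate_apply, Fin.coeSucc_eq_succ] at h1
    rw [← h1, ih]
    simp only [chainConfig, h]
    rw [Finset.sum_insert (by simp)]
    ring

theorem continuous_chainConfig (s : ℝ) {N : ℕ} :
    Continuous fun p : ℂ × (Fin N → Circle) => chainConfig s p.1 p.2 := by
  unfold chainConfig
  fun_prop

theorem joinedIn_chainConfig {s : ℝ} {N : ℕ} (π : Equiv.Perm (Fin N)) {u v : Fin N → Circle}
    (hu : ∀ i, u (π i) = -u i) (hv : ∀ i, v (π i) = -v i) (c d : ℂ) :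
    JoinedIn (triangleCycle s N).configurations (chainConfig s c u) (chainConfig s d v) := by
  obtain ⟨γ, hγ, h0, h1, hs⟩ := exists_path_of_antiinvariant π u v hu hv
  refine ⟨⟨⟨fun t => chainConfig s (c + (t : ℝ) * (d - c)) (γ t),
    (continuous_chainConfig s).comp (f := fun t : unitInterval => (c + (t : ℝ) * (d - c), γ t))
      (by fun_prop)⟩, ?_, ?_⟩, fun t => chainConfig_mem (hs t)⟩
  · simp [h0]
  · simp [h1]

theorem regularPosition_mem {s : ℝ} {N : ℕ} (hN : 2 ≤ N) :
    regularPosition s N ∈ (triangleCycle s N).configurations := by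
  rw [mem_configurations_triangleCycle]
  obtain ⟨N, rfl⟩ : ∃ M, N = M + 1 := ⟨N - 1, by omega⟩
  have hprim := Complex.isPrimitiveRoot_exp (N + 1) (by omega)
  set ζ := exp (2 * Real.pi * I / (N + 1 : ℕ)) with hζ
  have hne : ζ - 1 ≠ 0 := sub_ne_zero.mpr (hprim.ne_one (by omega))
  have hpow : ∀ i : ℕ, exp (2 * Real.pi * I * i / (N + 1 : ℕ)) = ζ ^ i := by
    intro i; rw [hζ, ← Complex.exp_nat_mul]; congr 1; ring
  have hcirc : ∀ i : ℕ, ((Circle.exp (2 * Real.pi * i / (N + 1 : ℕ)) : Circle) : ℂ) = ζ ^ i := by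
    intro i; rw [← hpow, Circle.coe_exp]; congr 1; push_cast; ring
  intro i
  simp only [regularPosition, hpow, hcirc, ← hζ]
  have : ζ ^ (finRotate (N + 1) i : ℕ) = ζ ^ (i + 1 : ℕ) := by
    rw [coe_finRotate]
    split_ifs with h
    · rw [h, Fin.val_last, hprim.pow_eq_one, pow_zero]
    · rfl
  rw [this]
  field_simp
  ring

/-- The index permutation that moves every edge of a `4n`-gon to the opposite one. -/
def oppositeEdge (n : ℕ) : Equiv.Perm (Fin (4 * n)) :=
  Function.Involutive.toPerm
    (fun i => ⟨if i.val < 2 * n then i + 2 * n else i - 2 * n, by split_ifs <;> omega⟩) (by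
      intro i; ext; dsimp only; split_ifs <;> omega)

/-- The index permutation that exchanges `2k` and `2k + 1`. -/
def neighbourEdge (n : ℕ) : Equiv.Perm (Fin (4 * n)) :=
  Function.Involutive.toPerm
    (fun i => ⟨if i.val % 2 = 0 then i + 1 else i - 1, by split_ifs <;> omega⟩) (by
      intro i; ext; dsimp only; split_ifs <;> omega)

theorem oppositeEdge_val (n : ℕ) (i : Fin (4 * n)) :
    (oppositeEdge n i : ℕ) = if i.val < 2 * n then i + 2 * n else i - 2 * n := rfl

theorem neighbourEdge_val (n : ℕ) (i : Fin (4 * n)) :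
    (neighbourEdge n i : ℕ) = if i.val % 2 = 0 then i.val + 1 else i.val - 1 := rfl

/-- The regular polygon can be folded flat. -/
theorem regularPosition_joinedIn {s : ℝ} {n : ℕ} (hn : 1 ≤ n) (c : ℂ) :
    JoinedIn (triangleCycle s (4 * n)).configurations (regularPosition s (4 * n))
      (chainConfig s c fun i => if Even i.val then 1 else -1) := by
  obtain ⟨n, rfl⟩ : ∃ M, n = M + 1 := ⟨n - 1, by omega⟩
  -- An intermediate flat state negated by both pairings: the opposite edge has the same parity but
  -- lies in the other half, while the neighbour lies in the same half and has the other parity.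
  -- Both facts use that half the number of edges is even.
  let w : Fin (4 * (n + 1)) → Circle := fun i => if (i.val < 2 * (n + 1) ↔ Even i.val) then 1 else -1
  have e := eq_chainConfig (g := regularPosition s (4 * (n + 1))) (N := 4 * n + 3)
    (regularPosition_mem (s := s) (N := 4 * (n + 1)) (by omega))
  have e' : regularPosition s (4 * (n + 1)) = _ := e
  rw [e']
  have hw₁ : ∀ i, w (oppositeEdge (n + 1) i) = -w i := by
    intro i
    have : ((oppositeEdge (n + 1) i : ℕ) < 2 * (n + 1) ↔ Even (oppositeEdge (n + 1) i : ℕ)) ↔ ¬ (i.val < 2 * (n + 1) ↔ Even i.val) := by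
      rw [oppositeEdge_val]
      simp only [Nat.even_iff]; split_ifs <;> omega
    simp only [w, this]
    split_ifs <;> simp
  have hw₂ : ∀ i, w (neighbourEdge (n + 1) i) = -w i := by
    intro i
    have : ((neighbourEdge (n + 1) i : ℕ) < 2 * (n + 1) ↔ Even (neighbourEdge (n + 1) i : ℕ)) ↔ ¬ (i.val < 2 * (n + 1) ↔ Even i.val) := by
      rw [neighbourEdge_val]
      simp only [Nat.even_iff]; split_ifs <;> omega
    simp only [w, this]
    split_ifs <;> simp
  refine (joinedIn_chainConfig (oppositeEdge (n + 1)) (v := w) ?_ hw₁ _ 0).trans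
    (joinedIn_chainConfig (neighbourEdge (n + 1)) hw₂ ?_ 0 c)
  · intro i
    simp only [regularPosition]
    have hN : ((4 * (n + 1) : ℕ) : ℝ) ≠ 0 := by positivity
    have key : ∀ x : ℝ, Circle.exp (x + Real.pi) = - Circle.exp x := by
      intro x; ext; simp
    rw [oppositeEdge_val]
    split_ifs with h
    · rw [← key]; congr 1; field_simp; push_cast; ring
    · rw [← neg_inj, neg_neg, ← key]
      congr 1
      push_cast [not_lt.mp h]; field_simp; ring
  · intro i
    have : Even (neighbourEdge (n + 1) i : ℕ) ↔ ¬ Even i.val := by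
      rw [neighbourEdge_val]
      simp only [Nat.even_iff]; split_ifs <;> omega
    simp only [this]
    split_ifs <;> simp

/-! ### Merging the cycles of a permutation. -/

-- Follow `σ` from `z` until `x` is first reached. The walk never meets `y`, so the transposition
-- does not affect it before it arrives.
open Equiv Perm in
theorem Equiv.Perm.SameCycle.mul_swap {α : Type*} [DecidableEq α] [Finite α] {σ : Perm α}
    {x y z : α} (hxy : ¬ σ.SameCycle x y) (hz : σ.SameCycle z x) :
    (σ * swap x y).SameCycle z x := by
  obtain ⟨m, hm⟩ := hz.exists_nat_pow_eq
  induction m generalizing z with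
  | zero =>
    obtain rfl : z = x := hm
    exact .refl _ _
  | succ m ih =>
    rcases eq_or_ne z x with rfl | hzx
    · exact .refl _ _
    have hzy : z ≠ y := by rintro rfl; exact hxy hz.symm
    have h1 : (σ * swap x y) z = σ z := by simp [swap_apply_of_ne_of_ne hzx hzy]
    have h2 := ih (z := σ z) (sameCycle_apply_left.mpr hz) (by rwa [pow_succ, mul_apply] at hm)
    rwa [← h1, sameCycle_apply_left] at h2

open Equiv Perm in
/-- Composition with a transposition merges two cycles. -/
theorem Equiv.Perm.SameCycle.mul_swap_of_or {α : Type*} [DecidableEq α] [Finite α] {σ : Perm α}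
    {x y z : α} (hxy : ¬ σ.SameCycle x y) (hz : σ.SameCycle z x ∨ σ.SameCycle z y) :
    (σ * swap x y).SameCycle z x := by
  have key : ∀ w, σ.SameCycle w y → (σ * swap x y).SameCycle w y := by
    intro w hw
    rw [swap_comm]
    exact hw.mul_swap fun h => hxy h.symm
  rcases hz with hz | hz
  · exact hz.mul_swap hxy
  -- It remains to link `x` and `y`: the new permutation sends `x` to `σ y`, and from there the old
  -- cycle of `y` leads back to `y`.
  · refine (key z hz).trans ?_
    have h := key (σ y) (sameCycle_apply_left.mpr (.refl _ _))
    have h1 : (σ * swap x y) x = σ y := by simp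
    rw [← h1, sameCycle_apply_left] at h
    exact h.symm

/-- The cyclic successor of a piece inside its group of four pieces. -/
def nextPiece (K : Type*) : Equiv.Perm (K × Fin 4) := (Equiv.refl K).prodCongr (Equiv.addRight 1)

@[simp] theorem nextPiece_apply {K : Type*} (x : K × Fin 4) : nextPiece K x = (x.1, x.2 + 1) := rfl

theorem sameCycle_of_apply_eq_nextPiece {K : Type*} {σ : Equiv.Perm (K × Fin 4)} {k : K}
    (h : ∀ j, σ (k, j) = (k, j + 1)) {x y : K × Fin 4} (hx : x.1 = k) (hy : y.1 = k) :
    σ.SameCycle x y := by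
  have step : ∀ j, σ.SameCycle (k, j) (k, j + 1) := by
    intro j
    rw [← h, Equiv.Perm.sameCycle_apply_right]
  have h1 : σ.SameCycle (k, 0) (k, 1) := step 0
  have h2 : σ.SameCycle (k, 0) (k, 2) := h1.trans (step 1)
  have h3 : σ.SameCycle (k, 0) (k, 3) := h2.trans (step 2)
  have key : ∀ j, σ.SameCycle (k, 0) (k, j) := by
    intro j
    fin_cases j
    exacts [.refl _ _, h1, h2, h3]
  obtain ⟨_, i⟩ := x
  obtain ⟨_, j⟩ := y
  subst hx
  obtain rfl := hy
  exact (key i).symm.trans (key j)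

open Equiv Perm in
/-- Groups of four pieces that are connected through the relation `r` are merged into one cycle by
exchanging successors along a matching contained in `r`. -/
theorem exists_matching {K : Type*} [Fintype K] [DecidableEq K] [Nonempty K]
    (r : K × Fin 4 → K × Fin 4 → Prop) (hsymm : ∀ x y, r x y → r y x)
    (huniq : ∀ x y z, r x y → r x z → y = z)
    (hconn : ∀ S : Finset K, S.Nonempty → S ≠ Finset.univ → ∃ x y, r x y ∧ x.1 ∈ S ∧ y.1 ∉ S) :
    ∃ τ : Perm (K × Fin 4), (∀ x, τ (τ x) = x) ∧ (∀ x, τ x = x ∨ r x (τ x)) ∧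
      ∀ x y, (nextPiece K * τ).SameCycle x y := by
  obtain ⟨k₀⟩ := ‹Nonempty K›
  -- A spanning tree is grown one group at a time: `τ` moves only pieces of groups already in `S`,
  -- and all of these lie in one cycle.
  have main : ∀ m, m + 1 ≤ Fintype.card K → ∃ S : Finset K, S.card = m + 1 ∧
      ∃ τ : Perm (K × Fin 4), (∀ x, τ (τ x) = x) ∧ (∀ x, τ x = x ∨ r x (τ x)) ∧
      (∀ x, τ x ≠ x → x.1 ∈ S) ∧
      ∀ x y, x.1 ∈ S → y.1 ∈ S → (nextPiece K * τ).SameCycle x y := by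
    intro m
    induction m with
    | zero =>
      intro _
      refine ⟨{k₀}, rfl, 1, by simp, by simp, by simp, ?_⟩
      intro x y hx hy
      rw [Finset.mem_singleton] at hx hy
      exact sameCycle_of_apply_eq_nextPiece (k := k₀) (fun j => by simp) hx hy
    | succ m ih =>
      intro hm
      obtain ⟨S, hS, τ, hinv, hr, hsupp, hcyc⟩ := ih (by omega)
      obtain ⟨x, y, hxy, hx, hy⟩ := hconn S (Finset.card_pos.mp (by omega)) (by
        rintro rfl; rw [Finset.card_univ] at hS; omega)
      have hxy' : x ≠ y := by rintro rfl; exact hy hx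
      have hτy : τ y = y := by by_contra h; exact hy (hsupp y h)
      -- The hinge `x` is still free: by uniqueness its only possible partner is `y`, which lies
      -- outside `S` and is fixed by `τ`.
      have hτx : τ x = x := by
        by_contra h
        have := huniq x y _ hxy ((hr x).resolve_left h)
        rw [this, hinv] at hτy
        exact h hτy.symm
      set σ := nextPiece K * τ with hσ
      have hστ : ∀ z, (σ z).1 ∈ S ↔ z.1 ∈ S := by
        intro z
        simp only [hσ, mul_apply, nextPiece_apply]
        by_cases h : τ z = z
        · rw [h]
        · have h' : τ (τ z) ≠ τ z := fun e => h (τ.injective e)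
          exact iff_of_true (hsupp _ h') (hsupp _ h)
      have hpow : ∀ (i : ℕ) z, ((σ ^ i) z).1 ∈ S ↔ z.1 ∈ S := by
        intro i
        induction i with
        | zero => simp
        | succ i ih => intro z; rw [pow_succ', mul_apply, hστ, ih]
      have hnot : ¬ σ.SameCycle x y := by
        intro h
        obtain ⟨i, hi⟩ := h.exists_nat_pow_eq
        exact hy (hi ▸ (hpow i x).mpr hx)
      have hσy : ∀ z, z.1 = y.1 → σ.SameCycle y z := by
        intro z hz
        refine sameCycle_of_apply_eq_nextPiece (fun j => ?_) rfl hz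
        have : τ (y.1, j) = (y.1, j) := by
          by_contra h
          exact hy (hsupp (y.1, j) h)
        rw [hσ, mul_apply, this, nextPiece_apply]
      refine ⟨insert y.1 S, by rw [Finset.card_insert_of_notMem hy, hS], τ * swap x y, ?_, ?_, ?_, ?_⟩
      · intro z
        simp only [mul_apply]
        rcases eq_or_ne z x with rfl | hzx
        · simp [hτx, hτy]
        rcases eq_or_ne z y with rfl | hzy
        · simp [hτx, hτy]
        rw [swap_apply_of_ne_of_ne hzx hzy, swap_apply_of_ne_of_ne, hinv]
        · intro h; rw [← hτx] at h; exact hzx (τ.injective h)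
        · intro h; rw [← hτy] at h; exact hzy (τ.injective h)
      · intro z
        simp only [mul_apply]
        rcases eq_or_ne z x with rfl | hzx
        · right; simpa [hτy] using hxy
        rcases eq_or_ne z y with rfl | hzy
        · right; simpa [hτx] using hsymm _ _ hxy
        rw [swap_apply_of_ne_of_ne hzx hzy]
        exact hr z
      · intro z hz
        rcases eq_or_ne z x with rfl | hzx
        · exact Finset.mem_insert_of_mem hx
        rcases eq_or_ne z y with rfl | hzy
        · exact Finset.mem_insert_self _ _
        rw [mul_apply, swap_apply_of_ne_of_ne hzx hzy] at hz
        exact Finset.mem_insert_of_mem (hsupp z hz)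
      · have key : ∀ z : K × Fin 4, z.1 ∈ insert y.1 S →
            (nextPiece K * (τ * swap x y)).SameCycle z x := by
          intro z hz
          rw [← mul_assoc]
          refine SameCycle.mul_swap_of_or hnot ?_
          rcases Finset.mem_insert.mp hz with h | h
          · exact .inr (hσy z h).symm
          · exact .inl (hcyc z x h hx)
        exact fun z w hz hw => (key z hz).trans (key w hw).symm
  have hpos : 0 < Fintype.card K := Fintype.card_pos_iff.mpr ⟨k₀⟩
  obtain ⟨S, hS, τ, h1, h2, -, h4⟩ := main (Fintype.card K - 1) (by omega)
  have : S = Finset.univ := Finset.eq_univ_of_card S (by omega)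
  subst this
  exact ⟨τ, h1, h2, fun x y => h4 x y (Finset.mem_univ _) (Finset.mem_univ _)⟩

/-- A permutation with a single cycle enumerates its domain. -/
theorem exists_enumeration {α : Type*} [Fintype α] (σ : Equiv.Perm α)
    (hσ : ∀ x y, σ.SameCycle x y) (x₀ : α) {N : ℕ} (hN : Fintype.card α = N) :
    ∃ e : Fin N ≃ α, (∀ i : Fin N, e i = (σ ^ (i : ℕ)) x₀) ∧ ∀ i, e (finRotate N i) = σ (e i) := by
  have hc : σ.IsCycleOn ((Finset.univ : Finset α) : Set α) :=
    ⟨by simp, fun x _ y _ => hσ x y⟩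
  have hcard : (Finset.univ : Finset α).card = N := by rw [Finset.card_univ, hN]
  have hsurj : Function.Surjective fun i : Fin N => (σ ^ (i : ℕ)) x₀ := by
    intro y
    obtain ⟨m, hm, rfl⟩ := hc.exists_pow_eq (Finset.mem_univ x₀) (Finset.mem_univ y)
    exact ⟨⟨m, hcard ▸ hm⟩, rfl⟩
  have hbij := (Fintype.bijective_iff_surjective_and_card _).mpr ⟨hsurj, by simp [hN]⟩
  refine ⟨Equiv.ofBijective _ hbij, fun i => rfl, fun i => ?_⟩
  obtain ⟨N, rfl⟩ : ∃ M, N = M + 1 := ⟨N - 1, by have := i.pos; omega⟩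
  simp only [Equiv.ofBijective_apply]
  rw [coe_finRotate, ← Equiv.Perm.mul_apply, ← pow_succ']
  split_ifs with h
  · have := hc.pow_card_apply (Finset.mem_univ x₀)
    rw [hcard] at this
    rw [h, Fin.val_last, this]; rfl
  · rfl

/-! ### Countable sets do not separate connected open sets of the plane. -/

open Topology

/-- A countable set does not separate a connected open set of the plane: if two closed sets with
countable intersection cover it, one of them has no interior there. -/
theorem IsPreconnected.not_countable_inter_of_closed_cover {O A B : Set ℂ} (hO : IsOpen O)
    (hc : IsPreconnected O) (hA : IsClosed A) (hB : IsClosed B) (hcov : O ⊆ A ∪ B)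
    (hOA : (O ∩ interior A).Nonempty) (hOB : (O ∩ interior B).Nonempty) : ¬ (A ∩ B).Countable := by
  intro hV
  set V := A ∩ B
  -- A ball is homeomorphic to the plane, so it stays connected without `V`; there `A` and `B` are
  -- disjoint, hence one of them contains the whole punctured ball.
  have hlocal : ∀ p ∈ O, (∀ᶠ z in 𝓝 p, z ∈ A ∪ V) ∨ ∀ᶠ z in 𝓝 p, z ∈ B ∪ V := by
    intro p hp
    obtain ⟨r, hr, hball⟩ := Metric.isOpen_iff.mp hO p hp
    have hD : IsPreconnected (Metric.ball p r \ V) := by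
      set f := OpenPartialHomeomorph.univBall p r
      have hsrc : f.source = Set.univ := OpenPartialHomeomorph.univBall_source p r
      have htgt : f.target = Metric.ball p r := OpenPartialHomeomorph.univBall_target p hr
      have hinj : Set.InjOn f (f ⁻¹' V) := f.injOn.mono (by rw [hsrc]; exact Set.subset_univ _)
      have hcount : (f ⁻¹' V).Countable :=
        Set.MapsTo.countable_of_injOn (Set.mapsTo_preimage f V) hinj hV
      have hconn : IsPreconnected (f ⁻¹' V)ᶜ :=
        (hcount.isConnected_compl_of_one_lt_rank (by
          rw [Complex.rank_real_complex]; norm_num)).isPreconnected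
      have himg : f '' (f ⁻¹' V)ᶜ = Metric.ball p r \ V := by
        ext z
        constructor
        · rintro ⟨w, hw, rfl⟩
          exact ⟨htgt ▸ f.map_source (hsrc ▸ Set.mem_univ w), hw⟩
        · rintro ⟨h1, h2⟩
          rw [← htgt] at h1
          refine ⟨f.symm z, ?_, f.right_inv h1⟩
          rw [Set.mem_compl_iff, Set.mem_preimage, f.right_inv h1]
          exact h2
      rw [← himg]
      exact hconn.image f ((hsrc ▸ f.continuousOn).mono (Set.subset_univ _))
    have hsub := isPreconnected_iff_subset_of_disjoint_closed.mp hD A B hA hB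
      (fun z hz => hcov (hball hz.1)) (by
        rw [Set.eq_empty_iff_forall_notMem]; rintro z ⟨⟨-, hz⟩, hz'⟩; exact hz hz')
    have hnhds := Metric.ball_mem_nhds p hr
    rcases hsub with h | h
    · left
      filter_upwards [hnhds] with z hz
      by_cases hzV : z ∈ V
      exacts [.inr hzV, .inl (h ⟨hz, hzV⟩)]
    · right
      filter_upwards [hnhds] with z hz
      by_cases hzV : z ∈ V
      exacts [.inr hzV, .inl (h ⟨hz, hzV⟩)]
  -- Both local conditions are open and together cover `O`, so by connectedness they hold together
  -- somewhere. There the countable `V` would be a neighbourhood.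
  obtain ⟨p, -, hpA, hpB⟩ := hc {p | ∀ᶠ z in 𝓝 p, z ∈ A ∪ V} {p | ∀ᶠ z in 𝓝 p, z ∈ B ∪ V}
    isOpen_setOfPred_eventually_nhds isOpen_setOfPred_eventually_nhds hlocal
    (by
      obtain ⟨p, hp, hpA⟩ := hOA
      exact ⟨p, hp, Filter.mem_of_superset (mem_interior_iff_mem_nhds.mp hpA) fun z hz => .inl hz⟩)
    (by
      obtain ⟨p, hp, hpB⟩ := hOB
      exact ⟨p, hp, Filter.mem_of_superset (mem_interior_iff_mem_nhds.mp hpB) fun z hz => .inl hz⟩)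
  have hpV : V ∈ 𝓝 p := by
    filter_upwards [hpA, hpB] with z h1 h2
    rcases h1 with h1 | h1
    · rcases h2 with h2 | h2
      exacts [⟨h1, h2⟩, h2]
    · exact h1
  have hdense := hV.dense_compl ℝ
  obtain ⟨z, hz1, hz2⟩ := hdense.inter_nhds_nonempty hpV
  exact hz1 hz2

/-! ### Members of a polyabolo and their common edges. -/

/-- The half-square with right angle at `R` and legs of length `2 * s` in the directions `u`, `I * u`. -/
noncomputable def placedModel (s : ℝ) (R : ℂ) (u : Circle) (m : Fin 3) : ℂ :=
  frame s R u (modelTri m)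

/-- A half-square is mirror symmetric, so a copy made by a reflection is also made by a rotation and
translation after its two acute vertices are exchanged. -/
theorem exists_placedModel_of_copy {ℓ : ℝ} (hℓ : 0 < ℓ) {v : Fin 3 → ℂ}
    (hv : ∃ φ : ℂ ≃ᵢ ℂ, ∀ m, v m = φ (halfSquare ℓ m)) :
    ∃ (R : ℂ) (u : Circle) (ρ : Equiv.Perm (Fin 3)), placedModel (ℓ / 2) R u = v ∘ ρ := by
  obtain ⟨φ, hφ⟩ := hv
  have hd : ∀ i j, ‖v i - v j‖ = ‖halfSquare ℓ i - halfSquare ℓ j‖ := by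
    intro i j
    rw [hφ, hφ, ← dist_eq_norm, ← dist_eq_norm, φ.isometry.dist_eq]
  have hℓ' : (ℓ : ℂ) ≠ 0 := by exact_mod_cast hℓ.ne'
  have h1 : ‖v 1 - v 0‖ = ℓ := by rw [hd]; simp [halfSquare, abs_of_pos hℓ]
  have h2 : ‖v 2 - v 0‖ = ℓ := by rw [hd]; simp [halfSquare, abs_of_pos hℓ]
  have h3 : ‖v 2 - v 1‖ = ℓ * ‖I - 1‖ := by
    rw [hd, show halfSquare ℓ 2 - halfSquare ℓ 1 = ℓ * (I - 1) by simp [halfSquare]; ring, norm_mul,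
      norm_real, Real.norm_eq_abs, abs_of_pos hℓ]
  have hb : v 1 - v 0 ≠ 0 := by rw [← norm_pos_iff, h1]; exact hℓ
  set w := (v 2 - v 0) / (v 1 - v 0) with hw
  have hwn : w.re * w.re + w.im * w.im = 1 := by
    have : ‖w‖ = 1 := by rw [hw, norm_div, h1, h2, div_self hℓ.ne']
    rw [← normSq_apply, normSq_eq_norm_sq, this]; norm_num
  have hwm : (w.re - 1) * (w.re - 1) + w.im * w.im = 2 := by
    have : ‖w - 1‖ = ‖I - 1‖ := by
      have e : w - 1 = (v 2 - v 1) / (v 1 - v 0) := by rw [hw]; field_simp; ring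
      rw [e, norm_div, h1, h3, mul_div_cancel_left₀ _ hℓ.ne']
    have e2 := congrArg (· ^ 2) this
    simp only [← normSq_eq_norm_sq, normSq_apply] at e2
    norm_num at e2
    exact e2
  -- The quotient `w` of the legs has modulus one and squared distance two from 1, which leaves only
  -- `I` and `-I`; the sign is the orientation of the copy.
  have hre : w.re = 0 := by linarith
  have him : w.im = 1 ∨ w.im = -1 := by
    rw [hre] at hwn
    exact mul_self_eq_one_iff.mp (by linarith)
  have hv2 : v 2 = v 0 + w * (v 1 - v 0) := by rw [hw]; field_simp; ring
  have hcirc : ∀ m, ‖v m - v 0‖ = ℓ → ∃ u : Circle, (ℓ : ℂ) * u = v m - v 0 := by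
    intro m hm
    refine ⟨⟨(v m - v 0) / ℓ, mem_sphere_zero_iff_norm.mpr ?_⟩, ?_⟩
    · rw [norm_div, hm, norm_real, Real.norm_eq_abs, abs_of_pos hℓ, div_self hℓ.ne']
    · exact mul_div_cancel₀ _ hℓ'
  rcases him with him | him
  · have hwI : w = I := Complex.ext (by simpa using hre) (by simpa using him)
    obtain ⟨u, hu⟩ := hcirc 1 h1
    refine ⟨v 0, u, 1, funext fun m => ?_⟩
    rw [hwI] at hv2
    fin_cases m
    · simp [placedModel, frame, modelTri]
    · simp [placedModel, frame, modelTri]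
      linear_combination hu
    · simp [placedModel, frame, modelTri]
      linear_combination I * hu - hv2
  · have hwI : w = -I := Complex.ext (by simpa using hre) (by simpa using him)
    obtain ⟨u, hu⟩ := hcirc 2 h2
    refine ⟨v 0, u, Equiv.swap 1 2, funext fun m => ?_⟩
    rw [hwI] at hv2
    fin_cases m
    · simp [placedModel, frame, modelTri, Equiv.swap_apply_def]
    · simp [placedModel, frame, modelTri]
      linear_combination hu
    · simp [placedModel, frame, modelTri]
      linear_combination I * hu + I * hv2 - (v 1 - v 0) * I_sq

theorem triRegion_comp_perm (v : Fin 3 → ℂ) (ρ : Equiv.Perm (Fin 3)) :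
    triRegion (v ∘ ρ) = triRegion v := by
  rw [triRegion, triRegion, EquivLike.range_comp]

theorem IsTriEdge.comp_perm {e : Set ℂ} {v : Fin 3 → ℂ} (h : IsTriEdge e v)
    (ρ : Equiv.Perm (Fin 3)) : IsTriEdge e (v ∘ ρ) := by
  obtain ⟨i, j, hij, rfl⟩ := h
  exact ⟨ρ.symm i, ρ.symm j, fun h => hij (ρ.symm.injective h), by simp⟩

/-- The condition on two members of a polyabolo. -/
def MeetProperly (v w : Fin 3 → ℂ) : Prop :=
  triRegion v ∩ triRegion w = ∅ ∨
  (∃ p, p ∈ Set.range v ∧ p ∈ Set.range w ∧ triRegion v ∩ triRegion w = {p}) ∨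
  ∃ e, IsTriEdge e v ∧ IsTriEdge e w ∧ triRegion v ∩ triRegion w = e

theorem MeetProperly.comp_perm {v w : Fin 3 → ℂ} (h : MeetProperly v w)
    (ρ ρ' : Equiv.Perm (Fin 3)) : MeetProperly (v ∘ ρ) (w ∘ ρ') := by
  unfold MeetProperly at h ⊢
  rw [triRegion_comp_perm, triRegion_comp_perm, EquivLike.range_comp, EquivLike.range_comp]
  refine h.imp_right (Or.imp_right ?_)
  rintro ⟨e, h1, h2, h3⟩
  exact ⟨e, h1.comp_perm ρ, h2.comp_perm ρ', h3⟩

theorem MeetProperly.disjoint_interior {v w : Fin 3 → ℂ} (h : MeetProperly v w) :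
    Disjoint (interior (triRegion v)) (interior (triRegion w)) := by
  rw [Set.disjoint_iff_inter_eq_empty, ← interior_inter]
  rcases h with h | ⟨p, -, -, h⟩ | ⟨e, ⟨i, j, -, rfl⟩, -, h⟩ <;> rw [h]
  · exact interior_empty
  · exact interior_singleton p
  · exact interior_segment_eq_empty

theorem frame_segment_halfEdge (s : ℝ) (R : ℂ) (u : Circle) (j : Fin 4) :
    frame s R u '' segment ℝ (subTri j 1 - halfEdge j) (subTri j 1 + halfEdge j) =
      segment ℝ (frame s R u (subTri j 1) - s * (u * halfEdge j))
        (frame s R u (subTri j 1) + s * (u * halfEdge j)) := by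
  rw [← frame_segment]
  congr 1 <;> simp only [frame] <;> ring

/-- Two members of a polyabolo in which the same point is the midpoint of an edge lie on different
sides of a common edge. -/
theorem MeetProperly.halfEdge_eq_neg {s : ℝ} (hs : 0 < s) {R R' : ℂ} {u u' : Circle}
    (h : MeetProperly (placedModel s R u) (placedModel s R' u')) {i j : Fin 4}
    (hp : frame s R u (subTri i 1) = frame s R' u' (subTri j 1)) :
    (u : ℂ) * halfEdge i = -(u' * halfEdge j) := by
  have hreg : ∀ (R : ℂ) (u : Circle), triRegion (placedModel s R u) = frame s R u '' triRegion modelTri :=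
    fun R u => triRegion_frame s R u modelTri
  have hs' : (s : ℂ) ≠ 0 := by exact_mod_cast hs.ne'
  have hmem : frame s R u (subTri i 1) ∈
      triRegion (placedModel s R u) ∩ triRegion (placedModel s R' u') := by
    refine ⟨?_, ?_⟩
    · rw [hreg]; exact Set.mem_image_of_mem _ (subTri_one_mem i)
    · rw [hreg, hp]; exact Set.mem_image_of_mem _ (subTri_one_mem j)
  rcases h with h | ⟨p, ⟨m, rfl⟩, -, h⟩ | ⟨e, he, he', h⟩
  · rw [h] at hmem; exact hmem.elim
  · rw [h] at hmem
    exact (subTri_one_ne_modelTri i m (frame_injective hs R u hmem)).elim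
  · obtain ⟨a, -, rfl⟩ := IsTriEdge.exists_eq_segment he
    obtain ⟨b, -, hb⟩ := IsTriEdge.exists_eq_segment he'
    have hmem1 := hmem
    have hmem2 := hmem
    rw [h] at hmem1
    rw [h, hb, hp] at hmem2
    rw [(frame_injective hs R u).mem_set_image] at hmem1
    rw [(frame_injective hs R' u').mem_set_image] at hmem2
    obtain ⟨-, h1⟩ := subTri_one_eq_of_mem_segment hmem1
    obtain ⟨-, h2⟩ := subTri_one_eq_of_mem_segment hmem2
    rw [frame_segment_halfEdge, frame_segment_halfEdge, ← h1, ← h2] at hb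
    rcases (segment_midpoint_unique hb).2 with h3 | h3
    -- If the edge vectors agreed, both triangles would lie on the same side of the edge and share a
    -- point off it, half an edge vector's length inward along the normal at the midpoint.
    · exfalso
      have h3 := mul_left_cancel₀ hs' h3
      have e1 : frame s R u (subTri i 1 + (1 / 2 : ℝ) * (I * halfEdge i)) =
          frame s R' u' (subTri j 1 + (1 / 2 : ℝ) * (I * halfEdge j)) := by
        simp only [frame] at hp ⊢
        linear_combination hp + s * (1 / 2 : ℝ) * I * h3
      have hmem3 : frame s R u (subTri i 1 + (1 / 2 : ℝ) * (I * halfEdge i)) ∈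
          triRegion (placedModel s R u) ∩ triRegion (placedModel s R' u') := by
        refine ⟨?_, ?_⟩
        · rw [hreg]; exact Set.mem_image_of_mem _ (subTri_one_add_mem i)
        · rw [hreg, e1]; exact Set.mem_image_of_mem _ (subTri_one_add_mem j)
      rw [h, (frame_injective hs R u).mem_set_image, ← h1] at hmem3
      obtain ⟨hsub, -⟩ := subTri_one_eq_of_mem_segment hmem1
      rw [← hsub] at hmem3
      obtain ⟨x, y, -, -, hxy, hz⟩ := hmem3
      have hxy' : (x : ℂ) + y = 1 := by exact_mod_cast hxy
      have h4 : ((y - x : ℝ) : ℂ) * halfEdge i = ((1 / 2 : ℝ) * I) * halfEdge i := by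
        simp only [real_smul] at hz
        push_cast at hz ⊢
        linear_combination hz - subTri i 1 * hxy'
      have h5 := congrArg im (mul_right_cancel₀ (halfEdge_ne_zero i) h4)
      norm_num at h5
    · have h3 : (s : ℂ) * (u * halfEdge i) = s * -(u' * halfEdge j) := by rw [h3]; ring
      exact mul_left_cancel₀ hs' h3

/-- Two half-squares that do not share an edge have at most a vertex in common. -/
theorem MeetProperly.countable_or {s : ℝ} {R R' : ℂ} {u u' : Circle}
    (h : MeetProperly (placedModel s R u) (placedModel s R' u')) :
    (triRegion (placedModel s R u) ∩ triRegion (placedModel s R' u')).Countable ∨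
      ∃ i j : Fin 4, i ≠ 2 ∧ j ≠ 2 ∧ frame s R u (subTri i 1) = frame s R' u' (subTri j 1) := by
  rcases h with h | ⟨p, -, -, h⟩ | ⟨e, he, he', h⟩
  · left; rw [h]; exact Set.countable_empty
  · left; rw [h]; exact Set.countable_singleton p
  · right
    obtain ⟨a, ha, rfl⟩ := IsTriEdge.exists_eq_segment he
    obtain ⟨b, hb, h1⟩ := IsTriEdge.exists_eq_segment he'
    rw [frame_segment_halfEdge, frame_segment_halfEdge] at h1
    exact ⟨a, b, ha, hb, (segment_midpoint_unique h1).1⟩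

theorem isClosed_triRegion (v : Fin 3 → ℂ) : IsClosed (triRegion v) :=
  ((Set.finite_range v).isCompact_convexHull ℝ).isClosed

/-- If the interior of a union of half-squares is connected, every proper part of the collection
has an edge in common with the rest. -/
theorem exists_common_edge {K : Type*} [Fintype K] {s : ℝ} (hs : 0 < s) {R : K → ℂ}
    {u : K → Circle}
    (hmeet : ∀ j k, j ≠ k → MeetProperly (placedModel s (R j) (u j)) (placedModel s (R k) (u k)))
    (hconn : IsPreconnected (interior (⋃ k, triRegion (placedModel s (R k) (u k)))))
    (S : Finset K) (hS : S.Nonempty) (hS' : S ≠ Finset.univ) :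
    ∃ k ∈ S, ∃ l ∉ S, ∃ i j : Fin 4, i ≠ 2 ∧ j ≠ 2 ∧
      frame s (R k) (u k) (subTri i 1) = frame s (R l) (u l) (subTri j 1) := by
  by_contra! hno
  set T : K → Set ℂ := fun k => triRegion (placedModel s (R k) (u k))
  have hclosed : ∀ P : Set K, IsClosed (⋃ k ∈ P, T k) := fun P =>
    P.toFinite.isClosed_biUnion fun k _ => isClosed_triRegion _
  have hint : ∀ (P : Set K) k, k ∈ P →
      (interior (⋃ k, T k) ∩ interior (⋃ k ∈ P, T k)).Nonempty := by
    intro P k hk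
    obtain ⟨z, hz⟩ := nonempty_interior_triRegion_frame hs (R k) (u k)
    exact ⟨z, interior_mono (Set.subset_iUnion T k) hz,
      interior_mono (Set.subset_biUnion_of_mem (u := T) hk) hz⟩
  obtain ⟨k, hk⟩ := hS
  obtain ⟨l, hl⟩ : ∃ l, l ∉ S := by
    by_contra! h; exact hS' (Finset.eq_univ_iff_forall.mpr h)
  refine IsPreconnected.not_countable_inter_of_closed_cover isOpen_interior hconn
    (hclosed {k | k ∈ S}) (hclosed {k | k ∉ S}) ?_ (hint _ k hk) (hint _ l hl) ?_
  · intro z hz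
    obtain ⟨i, hi⟩ := Set.mem_iUnion.mp (interior_subset hz)
    by_cases h : i ∈ S
    · exact .inl (Set.mem_biUnion (t := T) h hi)
    · exact .inr (Set.mem_biUnion (t := T) h hi)
  -- Without a common edge, the two parts meet in a finite union of countable intersections of
  -- pairs.
  · simp only [Set.iUnion_inter, Set.inter_iUnion]
    refine Set.countable_iUnion fun i => Set.countable_iUnion fun hi => Set.countable_iUnion fun j =>
      Set.countable_iUnion fun hj => ?_
    have hij : j ≠ i := by rintro rfl; exact hi hj
    exact ((hmeet j i hij).countable_or).resolve_right
      fun ⟨a, b, ha, hb, h⟩ => hno j hj i hi a b ha hb h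

/-! ### Directions of the pieces and of their corners at the hinges. -/

/-- The imaginary unit as a point of the unit circle. -/
noncomputable def circleI : Circle := ⟨I, mem_sphere_zero_iff_norm.mpr norm_I⟩

/-- The directions of the hinged edges of the four pieces of `modelTri`. -/
noncomputable def pieceTurn : Fin 4 → Circle := ![circleI, -1, 1, -circleI]

/-- This makes the final placement antisymmetric under reversal of the pieces within each
half-square. -/
theorem pieceTurn_rev (j : Fin 4) : pieceTurn j.rev = -pieceTurn j := by
  fin_cases j <;> simp [pieceTurn, Fin.rev]

/-- Unit vector into the corner of the piece `j` at the end of its hinged edge, relative to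
`halfEdge j`. -/
noncomputable def cornerIn : Fin 4 → ℂ :=
  ![⟨-3 / (2 * √5), 1 / (2 * √5)⟩, ⟨-1 / √2, 1 / √2⟩, ⟨1 / (2 * √5), 3 / (2 * √5)⟩,
    ⟨-1 / √2, 1 / √2⟩]

/-- Unit vector into the corner of the piece `j + 1` at the start of its hinged edge, relative to
`halfEdge j`. -/
noncomputable def cornerOut : Fin 4 → ℂ :=
  ![⟨3 / (2 * √5), 1 / (2 * √5)⟩, ⟨1 / √2, 1 / √2⟩, ⟨-1 / (2 * √5), 3 / (2 * √5)⟩,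
    ⟨1 / √2, 1 / √2⟩]

theorem cornerIn_re_neg {j : Fin 4} (hj : j ≠ 2) : (cornerIn j).re < 0 := by
  match j with
  | 0 => exact div_neg_of_neg_of_pos (by norm_num) (by positivity)
  | 1 => exact div_neg_of_neg_of_pos (by norm_num) (by positivity)
  | 2 => exact absurd rfl hj
  | 3 => exact div_neg_of_neg_of_pos (by norm_num) (by positivity)

theorem cornerOut_re_pos {j : Fin 4} (hj : j ≠ 2) : 0 < (cornerOut j).re := by
  match j with
  | 0 => exact div_pos (by norm_num) (by positivity)
  | 1 => exact div_pos (by norm_num) (by positivity)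
  | 2 => exact absurd rfl hj
  | 3 => exact div_pos (by norm_num) (by positivity)

theorem cornerIn_im_pos (j : Fin 4) : 0 < (cornerIn j).im := by
  match j with
  | 0 | 1 | 2 | 3 => exact div_pos (by norm_num) (by positivity)

theorem cornerOut_im_pos (j : Fin 4) : 0 < (cornerOut j).im := by
  match j with
  | 0 | 1 | 2 | 3 => exact div_pos (by norm_num) (by positivity)

/-- The threshold `1 / √5` is halfway between the heights `1 / (2 * √5)` of the outer corners and `3
/ (2 * √5)` of the middle corners at the midpoint of the hypotenuse. -/
theorem corner_zero_im_lt : (cornerIn 0).im < 1 / √5 ∧ (cornerOut 0).im < 1 / √5 := by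
  have h : 0 < √5 := by positivity
  change 1 / (2 * √5) < 1 / √5 ∧ 1 / (2 * √5) < 1 / √5
  rw [and_self]
  gcongr
  linarith

theorem lt_corner_two_im : 1 / √5 < (cornerIn 2).im ∧ 1 / √5 < (cornerOut 2).im := by
  have h : 0 < √5 := by positivity
  change 1 / √5 < 3 / (2 * √5) ∧ 1 / √5 < 3 / (2 * √5)
  rw [and_self, div_lt_div_iff₀ h (by positivity)]
  linarith

theorem cornerDir_frame {s : ℝ} (hs : 0 < s) (R : ℂ) (u : Circle) (v : Fin 3 → ℂ) (m : Fin 3)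
    {w : ℂ} (hw : (∑ i, frame s R u (v i)) / 3 - frame s R u (v m) = w) :
    w / (‖w‖ : ℂ) = u * ((v 0 + v 1 + v 2 - 3 * v m) / (‖v 0 + v 1 + v 2 - 3 * v m‖ : ℂ)) := by
  set z := v 0 + v 1 + v 2 - 3 * v m with hz
  have h1 : w = ((s / 3 : ℝ) : ℂ) * (u * z) := by
    rw [← hw, Fin.sum_univ_three, hz]; simp only [frame]; push_cast; ring
  have h2 : ‖w‖ = s / 3 * ‖z‖ := by
    rw [h1, norm_mul, norm_mul, Circle.norm_coe, one_mul, norm_real, Real.norm_eq_abs,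
      abs_of_pos (by positivity)]
  have h3 : ((s / 3 : ℝ) : ℂ) ≠ 0 := by exact_mod_cast (by positivity : s / 3 ≠ 0)
  rw [h2, h1, ofReal_mul, mul_div_mul_left _ _ h3, mul_div_assoc]

theorem div_norm_eq {z z' w : ℂ} {t : ℝ} (h : z = z') (hn : z'.re * z'.re + z'.im * z'.im = t)
    (hre : z'.re / √t = w.re) (him : z'.im / √t = w.im) : z / (‖z‖ : ℂ) = w := by
  rw [h, norm_def, normSq_apply, hn]
  exact Complex.ext (by rw [div_ofReal_re, hre]) (by rw [div_ofReal_im, him])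

theorem div_norm_subTri_one (j : Fin 4) :
    (subTri j 0 + subTri j 1 + subTri j 2 - 3 * subTri j 1) /
      (‖subTri j 0 + subTri j 1 + subTri j 2 - 3 * subTri j 1‖ : ℂ) = halfEdge j * cornerIn j := by
  match j with
  | 0 =>
    have e : subTri 0 0 + subTri 0 1 + subTri 0 2 - 3 * subTri 0 1 = 1 - 2 * I := by
      change 1 + (1 + I) + 2 - 3 * (1 + I) = (1 - 2 * I : ℂ); ring
    exact div_norm_eq e (t := 5) (by norm_num)
      (by simp [halfEdge_values, cornerIn]; field_simp; norm_num) (by simp [halfEdge_values, cornerIn]; field_simp; norm_num)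
  | 1 =>
    have e : subTri 1 0 + subTri 1 1 + subTri 1 2 - 3 * subTri 1 1 = 1 + I := by
      change (1 + I) + I + 2 * I - 3 * I = (1 + I : ℂ); ring
    exact div_norm_eq e (t := 2) (by norm_num)
      (by simp [halfEdge_values, cornerIn]) (by simp [halfEdge_values, cornerIn]; ring)
  | 2 =>
    have e : subTri 2 0 + subTri 2 1 + subTri 2 2 - 3 * subTri 2 1 = -2 - I := by
      change I + (1 + I) + 0 - 3 * (1 + I) = (-2 - I : ℂ); ring
    exact div_norm_eq e (t := 5) (by norm_num)
      (by simp [halfEdge_values, cornerIn]; field_simp; norm_num) (by simp [halfEdge_values, cornerIn]; field_simp; norm_num)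
  | 3 =>
    have e : subTri 3 0 + subTri 3 1 + subTri 3 2 - 3 * subTri 3 1 = -1 + I := by
      change (1 + I) + 1 + 0 - 3 * 1 = (-1 + I : ℂ); ring
    exact div_norm_eq e (t := 2) (by norm_num)
      (by simp [halfEdge_values, cornerIn]) (by simp [halfEdge_values, cornerIn])

theorem div_norm_subTri_zero (j : Fin 4) :
    (subTri (j + 1) 0 + subTri (j + 1) 1 + subTri (j + 1) 2 - 3 * subTri (j + 1) 0) /
      (‖subTri (j + 1) 0 + subTri (j + 1) 1 + subTri (j + 1) 2 - 3 * subTri (j + 1) 0‖ : ℂ) =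
      halfEdge j * cornerOut j := by
  match j with
  | 0 =>
    have e : subTri 1 0 + subTri 1 1 + subTri 1 2 - 3 * subTri 1 0 = -2 + I := by
      change (1 + I) + I + 2 * I - 3 * (1 + I) = (-2 + I : ℂ); ring
    exact div_norm_eq e (t := 5) (by norm_num)
      (by simp [halfEdge_values, cornerOut]; field_simp; norm_num) (by simp [halfEdge_values, cornerOut]; field_simp; norm_num)
  | 1 =>
    have e : subTri 2 0 + subTri 2 1 + subTri 2 2 - 3 * subTri 2 0 = 1 - I := by
      change I + (1 + I) + 0 - 3 * I = (1 - I : ℂ); ring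
    exact div_norm_eq e (t := 2) (by norm_num)
      (by simp [halfEdge_values, cornerOut]) (by simp [halfEdge_values, cornerOut]; ring)
  | 2 =>
    have e : subTri 3 0 + subTri 3 1 + subTri 3 2 - 3 * subTri 3 0 = -1 - 2 * I := by
      change (1 + I) + 1 + 0 - 3 * (1 + I) = (-1 - 2 * I : ℂ); ring
    exact div_norm_eq e (t := 5) (by norm_num)
      (by simp [halfEdge_values, cornerOut]; field_simp; norm_num) (by simp [halfEdge_values, cornerOut]; field_simp; norm_num)
  | 3 =>
    have e : subTri 0 0 + subTri 0 1 + subTri 0 2 - 3 * subTri 0 0 = 1 + I := by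
      change 1 + (1 + I) + 2 - 3 * 1 = (1 + I : ℂ); ring
    exact div_norm_eq e (t := 2) (by norm_num)
      (by simp [halfEdge_values, cornerOut]) (by simp [halfEdge_values, cornerOut])

/-! ### Hinges facing each other across common edges, and non-crossing. -/

section Placement

variable {K : Type*} (s : ℝ) (R : K → ℂ) (u : K → Circle)

/-- The end of the hinged edge of a piece, which is the midpoint of an edge of its half-square. -/
noncomputable def edgeMid (x : K × Fin 4) : ℂ := frame s (R x.1) (u x.1) (subTri x.2 1)

/-- The direction of the edge that has `edgeMid x` as its midpoint. -/
noncomputable def edgeVec (x : K × Fin 4) : ℂ := u x.1 * halfEdge x.2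

/-- The rigid motion that puts a piece into its place. -/
noncomputable def piecePlace (x : K × Fin 4) : Circle × ℂ :=
  (u x.1 * pieceTurn x.2, frame s (R x.1) (u x.1) (subTri x.2 0))

/-- The pieces `x` and `y` end at the midpoint of a common edge of their half-squares. -/
def Facing (x y : K × Fin 4) : Prop :=
  x.2 ≠ 2 ∧ y.2 ≠ 2 ∧ x.1 ≠ y.1 ∧ edgeMid s R u x = edgeMid s R u y

variable {s R u}

theorem Facing.symm {x y : K × Fin 4} (h : Facing s R u x y) : Facing s R u y x :=
  ⟨h.2.1, h.1, h.2.2.1.symm, h.2.2.2.symm⟩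

theorem edgeVec_ne_zero (x : K × Fin 4) : edgeVec u x ≠ 0 :=
  mul_ne_zero (Circle.coe_ne_zero _) (halfEdge_ne_zero _)

theorem subTri_eq_of_edgeMid_eq (hs : 0 < s) {x y : K × Fin 4} (h1 : x.1 = y.1)
    (h : edgeMid s R u x = edgeMid s R u y) : subTri x.2 1 = subTri y.2 1 := by
  unfold edgeMid at h
  rw [h1] at h
  exact frame_injective hs _ _ h

/-- Three half-squares cannot share an edge: pairwise opposite edge vectors would make one equal to
its own negative. Within one half-square, excluding index 2 makes the hinge unique. -/
theorem Facing.unique (hs : 0 < s)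
    (hopp : ∀ x y, x.1 ≠ y.1 → edgeMid s R u x = edgeMid s R u y → edgeVec u x = -edgeVec u y)
    {x y z : K × Fin 4} (h : Facing s R u x y) (h' : Facing s R u x z) : y = z := by
  have hm : edgeMid s R u y = edgeMid s R u z := h.2.2.2.symm.trans h'.2.2.2
  by_cases h1 : y.1 = z.1
  · exact Prod.ext h1 (subTri_one_injOn h.2.1 h'.2.1 (subTri_eq_of_edgeMid_eq hs h1 hm))
  · have e1 := hopp _ _ h1 hm
    have e2 := hopp _ _ h.2.2.1 h.2.2.2
    have e3 := hopp _ _ h'.2.2.1 h'.2.2.2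
    rw [e3, neg_inj] at e2
    rw [← e2] at e1
    exact absurd (self_eq_neg.mp e1) (edgeVec_ne_zero z)

/-- Even indices belong to the hypotenuse and odd ones to legs, and edges of different lengths never
match. Exchanging successors therefore preserves the alternation of orientations. -/
theorem Facing.even_iff
    (hopp : ∀ x y, x.1 ≠ y.1 → edgeMid s R u x = edgeMid s R u y → edgeVec u x = -edgeVec u y)
    {x y : K × Fin 4} (h : Facing s R u x y) : Even x.2.val ↔ Even y.2.val := by
  have e := congrArg (fun z => ‖z‖ ^ 2) (hopp _ _ h.2.2.1 h.2.2.2)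
  simp only [edgeVec, norm_neg, norm_mul, Circle.norm_coe, one_mul, ← normSq_eq_norm_sq] at e
  generalize x.2 = i at e ⊢
  generalize y.2 = j at e ⊢
  fin_cases i <;> fin_cases j <;> first
    | decide
    | (exfalso; norm_num [halfEdge, normSq_apply] at e)

/-- At the midpoint of the hypotenuse of a half-square, the directions into all corners except its
two middle ones have a component less than `1 / √5` along the inner normal of the hypotenuse. -/
theorem corner_im_lt (hs : 0 < s)
    (hopp : ∀ x y, x.1 ≠ y.1 → edgeMid s R u x = edgeMid s R u y → edgeVec u x = -edgeVec u y)
    {x z : K × Fin 4} (hx : x.2 = 2) (hzx : z ≠ x) (h : edgeMid s R u z = edgeMid s R u x) :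
    (-I * (edgeVec u x)⁻¹ * (edgeVec u z * cornerIn z.2)).re < 1 / √5 ∧
    (-I * (edgeVec u x)⁻¹ * (edgeVec u z * cornerOut z.2)).re < 1 / √5 := by
  have hne := edgeVec_ne_zero (u := u) x
  by_cases h1 : z.1 = x.1
  · have hz2 : z.2 ≠ 2 := fun h2 => hzx (Prod.ext h1 (h2.trans hx.symm))
    have hz0 : z.2 = 0 := by
      refine eq_zero_of_subTri_one_eq hz2 ?_
      rw [subTri_eq_of_edgeMid_eq hs h1 h, hx]
    have hv : edgeVec u z = edgeVec u x := by
      simp only [edgeVec, h1, hz0, hx]; rfl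
    have e : ∀ c : ℂ, (-I * (edgeVec u x)⁻¹ * (edgeVec u z * c)).re = c.im := by
      intro c
      rw [hv, show -I * (edgeVec u x)⁻¹ * (edgeVec u x * c) = -I * c by field_simp]
      simp
    rw [e, e, hz0]
    exact corner_zero_im_lt
  · have hv := hopp _ _ h1 h
    have e : ∀ c : ℂ, (-I * (edgeVec u x)⁻¹ * (edgeVec u z * c)).re = -c.im := by
      intro c
      rw [hv, show -I * (edgeVec u x)⁻¹ * (-edgeVec u x * c) = I * c by field_simp]
      simp
    rw [e, e]
    have h5 : 0 < 1 / √5 := by positivity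
    exact ⟨by linarith [cornerIn_im_pos z.2], by linarith [cornerOut_im_pos z.2]⟩

/-- The hinges obtained by exchanging successors at common edges do not cross. -/
theorem not_hinges_cross (hs : 0 < s)
    (hopp : ∀ x y, x.1 ≠ y.1 → edgeMid s R u x = edgeMid s R u y → edgeVec u x = -edgeVec u y)
    {τ : Equiv.Perm (K × Fin 4)} (hinv : ∀ x, τ (τ x) = x)
    (hτ : ∀ x, τ x = x ∨ Facing s R u x (τ x)) {x y : K × Fin 4} (hxy : x ≠ y)
    (h : edgeMid s R u x = edgeMid s R u y) :
    ¬ (segment ℝ (edgeVec u x * cornerIn x.2) (edgeVec u (τ x) * cornerOut (τ x).2) ∩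
      segment ℝ (edgeVec u y * cornerIn y.2) (edgeVec u (τ y) * cornerOut (τ y).2)).Nonempty := by
  have hmid : ∀ z, edgeMid s R u (τ z) = edgeMid s R u z := by
    intro z
    rcases hτ z with h | h
    · rw [h]
    · exact h.2.2.2.symm
  have main : ∀ x y : K × Fin 4, x ≠ y → edgeMid s R u x = edgeMid s R u y → x.2 = 2 →
    ¬ (segment ℝ (edgeVec u y * cornerIn y.2) (edgeVec u (τ y) * cornerOut (τ y).2) ∩
      segment ℝ (edgeVec u x * cornerIn x.2) (edgeVec u (τ x) * cornerOut (τ x).2)).Nonempty := by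
    intro x y hxy h hx
    have hτx : τ x = x := (hτ x).resolve_right fun h => h.1 hx
    have hτy : τ y ≠ x := fun e => hxy (by rw [← hinv y, e, hτx])
    have hne := edgeVec_ne_zero (u := u) x
    have e : ∀ c : ℂ, (-I * (edgeVec u x)⁻¹ * (edgeVec u x * c)).re = c.im := by
      intro c
      rw [show -I * (edgeVec u x)⁻¹ * (edgeVec u x * c) = -I * c by field_simp]
      simp
    -- A parallel to the hypotenuse at height `1 / √5` separates the inner hinge, which is never
    -- exchanged, from any other hinge at this point.
    refine not_segment_inter_nonempty (d := -I * (edgeVec u x)⁻¹) (c := 1 / √5)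
      (corner_im_lt hs hopp hx hxy.symm h.symm).1
      (corner_im_lt hs hopp hx hτy ((hmid y).trans h.symm)).2 ?_ ?_
    · rw [e, hx]; exact lt_corner_two_im.1
    · rw [hτx, e, hx]; exact lt_corner_two_im.2
  by_cases hx : x.2 = 2
  · rw [Set.inter_comm]; exact main x y hxy h hx
  by_cases hy : y.2 = 2
  · exact main y x hxy.symm h.symm hy
  have h1 : x.1 ≠ y.1 := fun h1 =>
    hxy (Prod.ext h1 (subTri_one_injOn hx hy (subTri_eq_of_edgeMid_eq hs h1 h)))
  have hf : Facing s R u x y := ⟨hx, hy, h1, h⟩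
  have hv : edgeVec u y = -edgeVec u x := by rw [hopp _ _ h1 h, neg_neg]
  have hne := edgeVec_ne_zero (u := u) x
  -- Unexchanged hinges stay in their own half-squares and are separated by the line of the common
  -- edge; exchanged ones bridge that edge on opposite sides of its perpendicular bisector.
  by_cases hτx : τ x = x
  · have hτy : τ y = y := by
      refine (hτ y).resolve_right fun h2 => ?_
      have := Facing.unique hs hopp h2 hf.symm
      exact hxy (by rw [← hτx, ← this, hinv])
    rw [hτx, hτy, Set.inter_comm, hv]
    have e : ∀ c : ℂ, (-I * (edgeVec u x)⁻¹ * (edgeVec u x * c)).re = c.im := by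
      intro c
      rw [show -I * (edgeVec u x)⁻¹ * (edgeVec u x * c) = -I * c by field_simp]
      simp
    refine not_segment_inter_nonempty (d := -I * (edgeVec u x)⁻¹) (c := 0) ?_ ?_ ?_ ?_
    · rw [neg_mul (edgeVec u x), mul_neg, neg_re, e]; linarith [cornerIn_im_pos y.2]
    · rw [neg_mul (edgeVec u x), mul_neg, neg_re, e]; linarith [cornerOut_im_pos y.2]
    · rw [e]; exact cornerIn_im_pos x.2
    · rw [e]; exact cornerOut_im_pos x.2
  · have hτxy : τ x = y := Facing.unique hs hopp ((hτ x).resolve_left hτx) hf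
    have hτyx : τ y = x := by rw [← hτxy, hinv]
    rw [hτxy, hτyx, hv]
    have e : ∀ c : ℂ, ((edgeVec u x)⁻¹ * (edgeVec u x * c)).re = c.re := by
      intro c
      rw [inv_mul_cancel_left₀ hne]
    refine not_segment_inter_nonempty (d := (edgeVec u x)⁻¹) (c := 0) ?_ ?_ ?_ ?_
    · rw [e]; exact cornerIn_re_neg hx
    · rw [neg_mul (edgeVec u x), mul_neg, neg_re, e]; linarith [cornerOut_re_pos hy]
    · rw [neg_mul (edgeVec u x), mul_neg, neg_re, e]; linarith [cornerIn_re_neg hy]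
    · rw [e]; exact cornerOut_re_pos hx

end Placement

/-! ### Assembling the hinged cycle and its motion. -/

theorem pieceTurn_mul (s : ℝ) (j : Fin 4) (m : Fin 3) :
    (pieceTurn j : ℂ) * (if Even j.val then ![0, (s : ℂ), -(s : ℂ) * I]
      else ![0, (s : ℂ), (s : ℂ) - (s : ℂ) * I]) m = s * (subTri j m - subTri j 0) := by
  have h0 : Even (0 : Fin 4).val := by decide
  have h1 : ¬ Even (1 : Fin 4).val := by decide
  have h2 : Even (2 : Fin 4).val := by decide
  have h3 : ¬ Even (3 : Fin 4).val := by decide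
  match j with
  | 0 =>
    rw [if_pos h0]
    change I * _ = _
    fin_cases m <;> apply Complex.ext <;> simp [subTri] <;> ring
  | 1 =>
    rw [if_neg h1]
    change (-1 : ℂ) * _ = _
    fin_cases m <;> apply Complex.ext <;> simp [subTri] <;> ring
  | 2 =>
    rw [if_pos h2]
    change (1 : ℂ) * _ = _
    fin_cases m <;> apply Complex.ext <;> simp [subTri]
  | 3 =>
    rw [if_neg h3]
    change -I * _ = _
    fin_cases m <;> apply Complex.ext <;> simp [subTri]

theorem triangleCycle_placed {K : Type*} {s : ℝ} {N : ℕ} {R : K → ℂ} {u : K → Circle}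
    (e : Fin N → K × Fin 4) (i : Fin N) (he : Even i.val ↔ Even (e i).2.val) (m : Fin 3) :
    (triangleCycle s N).placed (fun i => piecePlace s R u (e i)) i m =
      frame s (R (e i).1) (u (e i).1) (subTri (e i).2 m) := by
  have h := pieceTurn_mul s (e i).2 m
  unfold HingedTriangles.placed triangleCycle
  simp only [he, piecePlace, frame, Circle.coe_mul]
  linear_combination (u (e i).1 : ℂ) * h

theorem edgeMid_apply_of_matching {K : Type*} {s : ℝ} {R : K → ℂ} {u : K → Circle}
    {τ : Equiv.Perm (K × Fin 4)} (hτ : ∀ x, τ x = x ∨ Facing s R u x (τ x)) (x : K × Fin 4) :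
    edgeMid s R u (τ x) = edgeMid s R u x := by
  rcases hτ x with h | h
  · rw [h]
  · exact h.2.2.2.symm

theorem subTri_add_one_zero (j : Fin 4) : subTri (j + 1) 0 = subTri j 1 := by
  match j with
  | 0 | 1 | 2 | 3 => rfl

/-- A collection of half-squares that pairwise meet properly and whose union has connected interior
is formed by the hinged cycle. -/
theorem rotatesInto_iUnion_placedModel {n : ℕ} (hn : 1 ≤ n) {s : ℝ} (hs : 0 < s) {R : Fin n → ℂ}
    {u : Fin n → Circle}
    (hmeet : ∀ j k, j ≠ k → MeetProperly (placedModel s (R j) (u j)) (placedModel s (R k) (u k)))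
    (hconn : IsPreconnected (interior (⋃ k, triRegion (placedModel s (R k) (u k))))) :
    (triangleCycle s (4 * n)).RotatesInto (regularPosition s (4 * n))
      (⋃ k, triRegion (placedModel s (R k) (u k))) := by
  have hopp : ∀ x y : Fin n × Fin 4, x.1 ≠ y.1 → edgeMid s R u x = edgeMid s R u y →
      edgeVec u x = -edgeVec u y :=
    fun x y hxy h => (hmeet x.1 y.1 hxy).halfEdge_eq_neg hs h
  have : Nonempty (Fin n) := ⟨⟨0, hn⟩⟩
  obtain ⟨τ, hinv, hτ, hcyc⟩ := exists_matching (Facing s R u) (fun _ _ => Facing.symm)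
    (fun _ _ _ => Facing.unique hs hopp) (fun S hS hS' => by
      obtain ⟨k, hk, l, hl, i, j, hi, hj, h⟩ := exists_common_edge hs hmeet hconn S hS hS'
      exact ⟨(k, i), (l, j), ⟨hi, hj, fun e : k = l => hl (e ▸ hk), h⟩, hk, hl⟩)
  set σ := nextPiece (Fin n) * τ with hσ
  have hσ_apply : ∀ x, σ x = ((τ x).1, (τ x).2 + 1) := fun x => rfl
  have hσ_even : ∀ x, Even (σ x).2.val ↔ ¬ Even x.2.val := by
    intro x
    have h1 : Even x.2.val ↔ Even (τ x).2.val := by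
      rcases hτ x with h | h
      · rw [h]
      · exact h.even_iff hopp
    have h2 : ∀ j : Fin 4, Even (j + 1 : Fin 4).val ↔ ¬ Even j.val := by decide
    rw [hσ_apply, h2, h1]
  -- The enumeration starts at a piece of even index, so the parity of the position in the cycle
  -- agrees with that of the piece.
  obtain ⟨e, he, hrot⟩ := exists_enumeration σ hcyc (⟨0, hn⟩, 0) (N := 4 * n)
    (by simp [mul_comm])
  have heven : ∀ i : Fin (4 * n), Even i.val ↔ Even (e i).2.val := by
    have : ∀ m : ℕ, Even m ↔ Even ((σ ^ m) (⟨0, hn⟩, 0)).2.val := by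
      intro m
      induction m with
      | zero => simp
      | succ m ih => rw [pow_succ', Equiv.Perm.mul_apply, hσ_even, ← ih, Nat.even_add_one]
    intro i
    rw [he]
    exact this i
  set g : Fin (4 * n) → Circle × ℂ := fun i => piecePlace s R u (e i) with hg
  have hplaced : ∀ i m, (triangleCycle s (4 * n)).placed g i m =
      frame s (R (e i).1) (u (e i).1) (subTri (e i).2 m) :=
    fun i m => triangleCycle_placed e i (heven i) m
  have hplaced' : ∀ i, (triangleCycle s (4 * n)).placed g i =
      fun m => frame s (R (e i).1) (u (e i).1) (subTri (e i).2 m) := fun i => funext (hplaced i)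
  have hmid : ∀ i, (triangleCycle s (4 * n)).placed g i 1 = edgeMid s R u (e i) :=
    fun i => hplaced i 1
  have hnext : ∀ i, (triangleCycle s (4 * n)).placed g (finRotate _ i) 0 = edgeMid s R u (e i) := by
    intro i
    rw [hplaced, hrot, hσ_apply, subTri_add_one_zero]
    exact edgeMid_apply_of_matching hτ (e i)
  have hconfig : g ∈ (triangleCycle s (4 * n)).configurations :=
    fun i => (hmid i).trans (hnext i).symm
  have hdirA : ∀ i, (triangleCycle s (4 * n)).cornerDir g (i, 1) =
      edgeVec u (e i) * cornerIn (e i).2 := by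
    intro i
    unfold HingedTriangles.cornerDir
    simp only [hplaced]
    rw [cornerDir_frame hs (R (e i).1) (u (e i).1) (subTri (e i).2) 1 rfl, div_norm_subTri_one,
      edgeVec, mul_assoc]
  have hdirB : ∀ i, (triangleCycle s (4 * n)).cornerDir g (finRotate _ i, 0) =
      edgeVec u (τ (e i)) * cornerOut (τ (e i)).2 := by
    intro i
    unfold HingedTriangles.cornerDir
    simp only [hplaced, hrot, hσ_apply]
    rw [cornerDir_frame hs (R (τ (e i)).1) (u (τ (e i)).1) (subTri ((τ (e i)).2 + 1)) 0 rfl,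
      div_norm_subTri_zero, edgeVec, mul_assoc]
  refine ⟨g, ?_, ⟨hconfig, ?_, ?_, ?_⟩⟩
  · obtain ⟨n, rfl⟩ : ∃ M, n = M + 1 := ⟨n - 1, by omega⟩
    have hgc : g = chainConfig s (g 0).2 (fun i => (g i).1) := eq_chainConfig (N := 4 * n + 3) hconfig
    rw [hgc]
    let π : Equiv.Perm (Fin (4 * (n + 1))) :=
      e.permCongr.symm ((Equiv.refl (Fin (n + 1))).prodCongr Fin.revPerm)
    have hπ : ∀ i, e (π i) = ((e i).1, (e i).2.rev) := by
      intro i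
      simp only [π, Equiv.permCongr_symm, Equiv.permCongr_apply, Equiv.symm_symm, Equiv.apply_symm_apply]
      rfl
    -- The zigzag is negated by every permutation that changes parity, in particular by `π`, which
    -- also negates the target directions.
    refine (regularPosition_joinedIn hn 0).trans (joinedIn_chainConfig π ?_ ?_ 0 _)
    · intro i
      have h2 : ∀ j : Fin 4, Even j.rev.val ↔ ¬ Even j.val := by decide
      simp only [heven, hπ, h2]
      split_ifs <;> simp
    · intro i
      simp only [hg, piecePlace, hπ, pieceTurn_rev, mul_neg]
  · intro i j hij
    rw [hplaced', hplaced']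
    by_cases h : (e i).1 = (e j).1
    · rw [h]
      refine disjoint_interior_frame_subTri hs _ _ fun h' => hij (e.injective (Prod.ext h h'))
    · exact (hmeet _ _ h).disjoint_interior.mono
        (interior_mono (triRegion_frame_subTri_subset s _ _ _))
        (interior_mono (triRegion_frame_subTri_subset s _ _ _))
  · rintro k l hkl ⟨h1, h2⟩
    refine not_hinges_cross hs hopp hinv hτ (x := e k) (y := e l)
      (fun h => hkl (e.injective h)) ((hmid k).symm.trans (h1.trans (hmid l))) ?_
    rw [← hdirA, ← hdirB, ← hdirA, ← hdirB]
    exact h2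
  · simp only [hplaced']
    rw [e.surjective.iUnion_comp fun x : Fin n × Fin 4 =>
      triRegion fun m => frame s (R x.1) (u x.1) (subTri x.2 m), Set.iUnion_prod']
    exact Set.iUnion_congr fun k => iUnion_triRegion_frame_subTri s (R k) (u k)

theorem mainTheorem4 (n : ℕ) (hn : 1 ≤ n) (ℓ : ℝ) (hℓ : 0 < ℓ)
    (F : Fin n → Fin 3 → ℂ) (hF : IsPolyabolo ℓ n F) :
    (triangleCycle (ℓ / 2) (4 * n)).RotatesInto (regularPosition (ℓ / 2) (4 * n))
      (⋃ k, triRegion (F k)) := by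
  choose R u ρ h using fun k => exists_placedModel_of_copy hℓ (hF.copy k)
  have hreg : ∀ k, triRegion (placedModel (ℓ / 2) (R k) (u k)) = triRegion (F k) := by
    intro k; rw [h, triRegion_comp_perm]
  simp only [← hreg]
  refine rotatesInto_iUnion_placedModel hn (by positivity) (fun j k hjk => ?_) ?_
  · rw [h, h]
    exact MeetProperly.comp_perm (hF.meet j k hjk) _ _
  · simp only [hreg]
    exact hF.connected.isPreconnected
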